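/- Let $n\ge 2$, let $m>1$ be real, and let $\Omega\subset\mathbb{C}^n$ be a bounded $m$-convex domain with Dini-smooth boundary. That is, $\Omega$ is a bounded convex domain; there is $c>0$ such that $\delta_\Omega(z;v)\le c\,\delta_\Omega(z)^{1/m}$ for all $z\in\Omega$ and $v\in\mathbb{C}^n\setminus\{0\}$, where $\delta_\Omega(z)=\inf\{|z-\xi|:\xi\in\partial\Omega\}$ and $\delta_\Omega(z;v)=\inf\{|z-\xi|:\xi\in\partial\Omega\cap(z+\mathbb{C}v)\}$; and every $p\in\partial\Omega$ has a neighbourhood $U$ in which $\partial\Omega$ is $C^1$ and such that the modulus of continuity $\omega(t)=\sup\{|\vec n(x)-\vec n(y)|: x,y\in\partial\Omega\cap U,\ |x-y|<t\}$ of the outer unit normal $\vec n$ satisfies $\int_0^1\frac{\omega(t)}{t}\,dt<\infty$. Let $d_K$ be the Kobayashi distance of $\Omega$, that is, the infimum of $\int_0^1K_\Omega(\gamma(t);\dot\gamma(t))\,dt$ over piecewise $C^1$ curves in $\Omega$ joining two given points, where $K_\Omega(x;v)=\inf\{|\xi|: f:\mathbb{D}\to\Omega \text{ holomorphic},\ f(0)=x,\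 df_0(\xi)=v\}$. Let $L$ denote Euclidean length of curves. 1. There is a constant $C>0$ such that for all $x,y\in\Omega$ and every Kobayashi geodesic $[x,y]$ from $x$ to $y$ (the image of an isometric embedding of $[0,d_K(x,y)]$ into $(\Omega,d_K)$ with endpoints $x$ and $y$), $$L([x,y])\le C\,|x-y|^{1/m}.$$ 2. Suppose in addition that $(\Omega,d_K)$ is Gromov hyperbolic, that is, there is $\delta\ge0$ with $(x|y)_w\ge\min\{(x|z)_w,(z|y)_w\}-\delta$ for all $x,y,z,w\in\Omega$, where $(x|y)_w=\frac12\big(d_K(x,w)+d_K(y,w)-d_K(x,y)\big)$. Then for every $\lambda\ge1$ there is a constant $C'>0$ such that for all $x,y\in\Omega$ and every Kobayashi $\lambda$-quasi-geodesic $\gamma$ from $x$ to $y$ (a map $\gamma:[a,b]\to\Omega$ with $\gamma(a)=x$, $\gamma(b)=y$ and $\lambda^{-1}|s-t|\le d_K(\gamma(s),\gamma(t))\le\lambda|s-t|$ for all $s,t\in[a,b]$), $$L(\gamma)\le C'\,|x-y|^{1/m}.$$ -/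

import Mathlib

open Set MeasureTheory
open scoped ENNReal

noncomputable section

namespace GehringHayman

/-- The boundary distance `δ_Ω(x) = inf {|x - ξ| : ξ ∈ ∂Ω}`. -/
def bdryDist {E : Type*} [NormedAddCommGroup E] (Ω : Set E) (x : E) : ℝ :=
  Metric.infDist x (frontier Ω)

/-- The boundary distance in the complex direction `v`,
`δ_Ω(x; v) = inf {|x - ξ| : ξ ∈ ∂Ω ∩ (x + ℂ v)}` (used for `v ≠ 0`). -/
def bdryDistDir {E : Type*} [NormedAddCommGroup E] [InnerProductSpace ℂ E]
    (Ω : Set E) (x v : E) : ℝ :=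
  Metric.infDist x (frontier Ω ∩ range fun c : ℂ => x + c • v)

/-- `Ω` is a bounded `m`-convex domain: a bounded convex domain such that, for some `C > 0`,
`δ_Ω(z; v) ≤ C δ_Ω(z)^{1/m}` for all `z ∈ Ω` and all directions `v`; here `m > 1` is real. -/
structure IsBoundedMConvex {E : Type*} [NormedAddCommGroup E] [InnerProductSpace ℂ E]
    (m : ℝ) (Ω : Set E) : Prop where
  one_lt : 1 < m
  isOpen : IsOpen Ω
  nonempty : Ω.Nonempty
  convex : Convex ℝ Ω
  bounded : Bornology.IsBounded Ω
  exists_bound : ∃ C : ℝ, 0 < C ∧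
    ∀ z ∈ Ω, ∀ v : E, v ≠ 0 → bdryDistDir Ω z v ≤ C * bdryDist Ω z ^ (1 / m)

/-- `r` is a local `C¹` defining function of `Ω` on the open set `U`. -/
structure IsLocalDefiningFunction {E : Type*} [NormedAddCommGroup E] [InnerProductSpace ℂ E]
    (Ω U : Set E) (r : E → ℝ) : Prop where
  contDiffOn : ContDiffOn ℝ 1 r U
  fderiv_ne_zero : ∀ x ∈ U, fderiv ℝ r x ≠ 0
  inter_eq : Ω ∩ U = {x ∈ U | r x < 0}

/-- `ν` is the outer unit normal vector field of `∂Ω` on `∂Ω ∩ U`, where `r` is a local defining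
function of `Ω` on `U`: `|ν x| = 1`, and `ν x` is the positive multiple of the real gradient of `r`,
i.e. `dr_x(v) = |dr_x| Re ⟨ν x, v⟩` for all `v`. -/
def IsOuterUnitNormal {E : Type*} [NormedAddCommGroup E] [InnerProductSpace ℂ E]
    (Ω U : Set E) (r : E → ℝ) (ν : E → E) : Prop :=
  ∀ x ∈ frontier Ω ∩ U, ‖ν x‖ = 1 ∧ ∀ v : E, fderiv ℝ r x v = ‖fderiv ℝ r x‖ * (inner ℂ (ν x) v).re

/-- The modulus of continuity `ω(ν, S, t) = sup {|ν x - ν y| : |x - y| < t, x, y ∈ S}`. -/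
def modulusOfContinuity {E : Type*} [NormedAddCommGroup E] (ν : E → E) (S : Set E) (t : ℝ) : ℝ :=
  sSup {s : ℝ | ∃ x ∈ S, ∃ y ∈ S, ‖x - y‖ < t ∧ s = ‖ν x - ν y‖}

/-- `p ∈ ∂Ω` is a Dini-smooth boundary point: `∂Ω` is `C¹` near `p`, and on some neighbourhood
`U` of `p` the modulus of continuity `ω` of the outer unit normal on `∂Ω ∩ U` satisfies
`∫₀¹ ω(t) / t dt < ∞`. -/
def IsDiniSmoothAt {E : Type*} [NormedAddCommGroup E] [InnerProductSpace ℂ E]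
    (Ω : Set E) (p : E) : Prop :=
  ∃ (U : Set E) (r : E → ℝ) (ν : E → E), IsOpen U ∧ p ∈ U ∧
    IsLocalDefiningFunction Ω U r ∧ IsOuterUnitNormal Ω U r ν ∧
    IntegrableOn (fun t : ℝ => modulusOfContinuity ν (frontier Ω ∩ U) t / t) (Ioc 0 1)

/-- Every boundary point of `Ω` is a Dini-smooth boundary point. -/
def HasDiniSmoothBoundary {E : Type*} [NormedAddCommGroup E] [InnerProductSpace ℂ E]
    (Ω : Set E) : Prop :=
  ∀ p ∈ frontier Ω, IsDiniSmoothAt Ω p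

/-- The infinitesimal Kobayashi metric
`K_Ω(x; v) = inf {|ξ| : f : 𝔻 → Ω holomorphic, f(0) = x, df₀(ξ) = v}`. -/
def kobayashiMetric {E : Type*} [NormedAddCommGroup E] [InnerProductSpace ℂ E]
    (Ω : Set E) (x v : E) : ℝ :=
  sInf {s : ℝ | ∃ (ξ : ℂ) (f : ℂ → E), DifferentiableOn ℂ f (Metric.ball 0 1) ∧
    MapsTo f (Metric.ball 0 1) Ω ∧ f 0 = x ∧ ξ • deriv f 0 = v ∧ s = ‖ξ‖}

/-- `γ` restricts to a piecewise `C¹` curve `[0,1] → Ω` from `x` to `y`: it is continuous, and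
`C¹` on each of the closed intervals of some partition `0 = t₀ ≤ t₁ ≤ … ≤ t_N = 1`. -/
structure IsPiecewiseC1Curve {E : Type*} [NormedAddCommGroup E] [InnerProductSpace ℂ E]
    (Ω : Set E) (x y : E) (γ : ℝ → E) : Prop where
  continuousOn : ContinuousOn γ (Icc 0 1)
  piecewise : ∃ (N : ℕ) (t : ℕ → ℝ), Monotone t ∧ t 0 = 0 ∧ t N = 1 ∧
    ∀ i < N, ContDiffOn ℝ 1 γ (Icc (t i) (t (i + 1)))
  mapsTo : MapsTo γ (Icc 0 1) Ω
  source : γ 0 = x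
  target : γ 1 = y

/-- The Kobayashi length `∫₀¹ K_Ω(γ(t); γ'(t)) dt`, with values in `[0, ∞]`. -/
def kobayashiLength {E : Type*} [NormedAddCommGroup E] [InnerProductSpace ℂ E]
    (Ω : Set E) (γ : ℝ → E) : ℝ≥0∞ :=
  ∫⁻ t in Icc (0 : ℝ) 1, ENNReal.ofReal (kobayashiMetric Ω (γ t) (deriv γ t))

/-- The Kobayashi distance `d_K`: the infimum of the Kobayashi lengths of the piecewise `C¹`
curves in `Ω` from `x` to `y`. (This infimum is finite for `x, y` in a domain `Ω`.) -/
def kobayashiDist {E : Type*} [NormedAddCommGroup E] [InnerProductSpace ℂ E]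
    (Ω : Set E) (x y : E) : ℝ :=
  (⨅ (γ : ℝ → E) (_ : IsPiecewiseC1Curve Ω x y γ), kobayashiLength Ω γ).toReal

/-- `γ` restricted to `[0, d_K(x,y)]` is a Kobayashi geodesic of `Ω` from `x` to `y`, i.e. an
isometric embedding of `[0, d_K(x,y)]` in `(Ω, d_K)` with these endpoints. -/
structure IsKobayashiGeodesic {E : Type*} [NormedAddCommGroup E] [InnerProductSpace ℂ E]
    (Ω : Set E) (x y : E) (γ : ℝ → E) : Prop where
  mapsTo : MapsTo γ (Icc 0 (kobayashiDist Ω x y)) Ω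
  source : γ 0 = x
  target : γ (kobayashiDist Ω x y) = y
  isometry : ∀ s ∈ Icc 0 (kobayashiDist Ω x y), ∀ t ∈ Icc 0 (kobayashiDist Ω x y),
    kobayashiDist Ω (γ s) (γ t) = |s - t|

/-- `γ` restricted to `[a, b]` is a Kobayashi `lam`-quasi-geodesic of `Ω` from `x` to `y`, i.e.
`lam⁻¹ |s - t| ≤ d_K(γ s, γ t) ≤ lam |s - t|` on `[a, b]`. -/
structure IsKobayashiQuasiGeodesic {E : Type*} [NormedAddCommGroup E] [InnerProductSpace ℂ E]
    (Ω : Set E) (lam : ℝ) (x y : E) (a b : ℝ) (γ : ℝ → E) : Prop where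
  le : a ≤ b
  mapsTo : MapsTo γ (Icc a b) Ω
  source : γ a = x
  target : γ b = y
  lower : ∀ s ∈ Icc a b, ∀ t ∈ Icc a b, lam⁻¹ * |s - t| ≤ kobayashiDist Ω (γ s) (γ t)
  upper : ∀ s ∈ Icc a b, ∀ t ∈ Icc a b, kobayashiDist Ω (γ s) (γ t) ≤ lam * |s - t|

/-- The Gromov product `(x|y)_w` with respect to the Kobayashi distance of `Ω`. -/
def gromovProduct {E : Type*} [NormedAddCommGroup E] [InnerProductSpace ℂ E]
    (Ω : Set E) (w x y : E) : ℝ :=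
  (kobayashiDist Ω x w + kobayashiDist Ω y w - kobayashiDist Ω x y) / 2

/-- `(Ω, d_K)` is Gromov hyperbolic: for some `δ ≥ 0`,
`(x|y)_w ≥ min {(x|z)_w, (z|y)_w} - δ` for all `x, y, z, w ∈ Ω`. -/
def IsKobayashiGromovHyperbolic {E : Type*} [NormedAddCommGroup E] [InnerProductSpace ℂ E]
    (Ω : Set E) : Prop :=
  ∃ δ : ℝ, 0 ≤ δ ∧ ∀ x ∈ Ω, ∀ y ∈ Ω, ∀ z ∈ Ω, ∀ w ∈ Ω,
    min (gromovProduct Ω w x z) (gromovProduct Ω w z y) - δ ≤ gromovProduct Ω w x y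

/-- The Euclidean length (in `[0, ∞]`) of the curve `γ` restricted to `[a, b]`. -/
def euclideanLength {E : Type*} [NormedAddCommGroup E] (γ : ℝ → E) (a b : ℝ) : ℝ≥0∞ :=
  eVariationOn γ (Icc a b)

end GehringHayman

end

/-! Put `D = |x - y|` and write `δ` for the boundary distance. The proof shows that along the curve
`δ` is at most a multiple of `D` and decays exponentially away from one point. The `m`-convexity
turns this into a bound on Euclidean speed, which is then summed.

Lower bounds for `d_K` come from complex supporting functionals, which map `Ω` to a half-plane. They
give `δ(z) ≤ δ(w) exp(2 d_K(z,w))` (`bdryDist_le_mul_exp`) and, on the complex line through `z` and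
`w`, `|w - z| ≤ δ(z; w - z) (exp(2 d_K(z,w)) - 1)`. With `m`-convexity, the Euclidean displacement
at bounded Kobayashi distance is `O(δ^{1/m} d_K)`.

The upper bound `d_K(x,y) ≤ ½ log(1 + D/δ(x)) + ½ log(1 + D/δ(y)) + C` (`exists_kobayashiDist_le`)
uses Dini smoothness. If the normal oscillates by `w_k` at scale `2^{-k}`, there is an inner ball of
radius `R = 2^{-k}/2` up to a relative error `w_k²`. Moving along the inner normal at depths
comparable to `R w_k` then costs `½ log` of the depth ratio plus `O(w_k)`, and the Dini integral
makes `∑ w_k` finite.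

For `z` on a geodesic at distance `τ` from `x`, comparison of `δ(z)` with `δ(x)` and with `δ(y)`,
together with the upper bound, gives `δ(z) ≲ D exp(-2|τ - ½ log(D/δ(x))|)`. The speed is thus at
most a multiple of `D^{1/m}` times an integrable exponential (`exists_length_le`). If `D` is small
compared with `δ` at the endpoints, the curve is short in `d_K` and a direct estimate suffices.

Only `d_K(x,z) + d_K(z,y) ≤ d_K(x,y) + H` was used of the geodesic. For quasi-geodesics in a Gromov
hyperbolic domain, `quasiGeodesic_stability` supplies such an `H`. -/

namespace GehringHayman

variable {E : Type*} [NormedAddCommGroup E] [InnerProductSpace ℂ E] {Ω : Set E}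

/-! ### The infinitesimal Kobayashi metric: balls and half-planes. -/

theorem kobayashiMetric_nonneg (Ω : Set E) (x v : E) : 0 ≤ kobayashiMetric Ω x v :=
  Real.sInf_nonneg (by rintro _ ⟨ξ, f, -, -, -, -, rfl⟩; positivity)

theorem kobayashiMetric_le_of_disc {x v : E} {f : ℂ → E} {ξ : ℂ}
    (hf : DifferentiableOn ℂ f (Metric.ball 0 1)) (hm : MapsTo f (Metric.ball 0 1) Ω)
    (h0 : f 0 = x) (hv : ξ • deriv f 0 = v) : kobayashiMetric Ω x v ≤ ‖ξ‖ :=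
  csInf_le ⟨0, by rintro _ ⟨ξ, f, -, -, -, -, rfl⟩; positivity⟩ ⟨ξ, f, hf, hm, h0, hv, rfl⟩

/-- `|1 + uz|² - |z + u|² = (1 - |z|²)(1 - u²)`. This makes `z ↦ (z + u) / (1 + uz)` a self-map of
the disc, used to recentre discs. -/
theorem norm_add_lt_norm_one_add_mul {z : ℂ} {u : ℝ} (hz : ‖z‖ < 1) (hu : |u| < 1) :
    ‖z + u‖ < ‖1 + u * z‖ := by
  have hz2 : z.re ^ 2 + z.im ^ 2 < 1 := by
    have h : ‖z‖ ^ 2 = z.re ^ 2 + z.im ^ 2 := by rw [← Complex.normSq_eq_norm_sq, Complex.normSq_apply]; ring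
    nlinarith [norm_nonneg z]
  have hu2 : u ^ 2 < 1 := by rwa [sq_lt_one_iff_abs_lt_one]
  refine lt_of_pow_lt_pow_left₀ 2 (norm_nonneg _) ?_
  rw [← Complex.normSq_eq_norm_sq, ← Complex.normSq_eq_norm_sq, Complex.normSq_apply,
    Complex.normSq_apply]
  simp
  nlinarith [mul_pos (sub_pos.2 hz2) (sub_pos.2 hu2)]

/-- Upper bound for the Kobayashi metric along a diameter of a ball contained in the domain. -/
theorem kobayashiMetric_le_of_ball_subset {c e : E} {ρ u a : ℝ} (hρ : 0 < ρ) (hu : |u| < 1)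
    (he : ‖e‖ = 1) (hsub : Metric.ball c ρ ⊆ Ω) :
    kobayashiMetric Ω (c + (ρ * u) • e) (a • e) ≤ |a| / (ρ * (1 - u ^ 2)) := by
  have hu2 : u ^ 2 < 1 := by rwa [sq_lt_one_iff_abs_lt_one]
  have hden : ∀ z ∈ Metric.ball (0 : ℂ) 1, (1 + u * z : ℂ) ≠ 0 := fun z hz => by
    have := norm_add_lt_norm_one_add_mul (by simpa using hz) hu
    exact norm_pos_iff.1 ((norm_nonneg _).trans_lt this)
  have hd : ∀ z ∈ Metric.ball (0 : ℂ) 1,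
      HasDerivAt (fun z : ℂ => c + ((ρ : ℂ) * ((z + u) / (1 + u * z))) • e)
        (((ρ : ℂ) * ((1 * (1 + u * z) - (z + u) * (u * 1)) / (1 + u * z) ^ 2)) • e) z := fun z hz => by
    have h1 : HasDerivAt (fun z : ℂ => z + u) 1 z := (hasDerivAt_id z).add_const _
    have h2 : HasDerivAt (fun z : ℂ => 1 + u * z) (u * 1) z :=
      ((hasDerivAt_id z).const_mul (u : ℂ)).const_add 1
    exact (((h1.div h2 (hden z hz)).const_mul (ρ : ℂ)).smul_const e).const_add c
  have h := kobayashiMetric_le_of_disc (Ω := Ω) (x := c + (ρ * u) • e) (v := a • e)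
    (f := fun z : ℂ => c + ((ρ : ℂ) * ((z + u) / (1 + u * z))) • e)
    (ξ := ((a / (ρ * (1 - u ^ 2)) : ℝ) : ℂ))
    (fun z hz => (hd z hz).differentiableAt.differentiableWithinAt) ?_ ?_ ?_
  · refine h.trans_eq ?_
    rw [Complex.norm_real, Real.norm_eq_abs, abs_div, abs_of_pos (a := ρ * (1 - u ^ 2))]
    exact mul_pos hρ (by linarith)
  · intro z hz
    have hz' : ‖z‖ < 1 := by simpa using hz
    apply hsub
    rw [mem_ball_iff_norm, add_sub_cancel_left, norm_smul, he, mul_one, norm_mul, norm_div,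
      Complex.norm_real, Real.norm_of_nonneg hρ.le]
    have := norm_add_lt_norm_one_add_mul hz' hu
    have h1 : ‖z + u‖ / ‖1 + u * z‖ < 1 := (div_lt_one ((norm_nonneg _).trans_lt this)).2 this
    nlinarith
  · simp only [zero_add, mul_zero, add_zero, div_one]
    rw [← Complex.coe_smul (ρ * u) e]; push_cast; rfl
  · rw [(hd 0 (by simp)).deriv, smul_smul, ← Complex.coe_smul a e]
    congr 1
    have : (1 - (u : ℂ) ^ 2) ≠ 0 := by exact_mod_cast (by linarith : (1 - u ^ 2) ≠ 0)
    have hρ' : (ρ : ℂ) ≠ 0 := by exact_mod_cast hρ.ne'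
    push_cast
    field_simp
    ring

theorem kobayashiMetric_le_norm_div {x v : E} {ρ : ℝ} (hρ : 0 < ρ)
    (hsub : Metric.ball x ρ ⊆ Ω) : kobayashiMetric Ω x v ≤ ‖v‖ / ρ := by
  -- For `v = 0`, division by `‖v‖ = 0` gives `0`: the disc is constant and `ξ = 0`.
  have h := kobayashiMetric_le_of_disc (Ω := Ω) (x := x) (v := v)
    (f := fun z : ℂ => x + ((ρ / ‖v‖ : ℝ) : ℂ) • z • v) (ξ := ((‖v‖ / ρ : ℝ) : ℂ)) ?_ ?_ ?_ ?_
  · refine h.trans_eq ?_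
    rw [Complex.norm_real, Real.norm_of_nonneg (by positivity)]
  · fun_prop
  · intro z hz
    have hz' : ‖z‖ < 1 := by simpa using hz
    apply hsub
    rw [mem_ball_iff_norm, add_sub_cancel_left, norm_smul, norm_smul,
      Complex.norm_real, Real.norm_of_nonneg (by positivity)]
    rcases eq_or_ne ‖v‖ 0 with h0 | h0
    · simpa [h0] using hρ
    · calc ρ / ‖v‖ * (‖z‖ * ‖v‖) = ρ * ‖z‖ := by field_simp
        _ < ρ := by nlinarith
  · simp
  · have : HasDerivAt (fun z : ℂ => x + ((ρ / ‖v‖ : ℝ) : ℂ) • z • v)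
        (((ρ / ‖v‖ : ℝ) : ℂ) • (1 : ℂ) • v) 0 :=
      ((((hasDerivAt_id (0 : ℂ)).smul_const v).const_smul _).const_add x)
    rw [this.deriv, one_smul, smul_smul]
    rcases eq_or_ne v 0 with h0 | h0
    · simp [h0]
    · have : ‖v‖ ≠ 0 := norm_ne_zero_iff.2 h0
      rw [← Complex.ofReal_mul, div_mul_div_comm, mul_comm ρ, div_self (by positivity)]
      simp

/-- The Schwarz lemma for maps of the disc to the right half-plane. -/
theorem norm_deriv_le_of_re_pos {h : ℂ → ℂ} (hd : DifferentiableOn ℂ h (Metric.ball 0 1))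
    (hpos : ∀ z ∈ Metric.ball (0 : ℂ) 1, 0 < (h z).re) : ‖deriv h 0‖ ≤ 2 * (h 0).re := by
  have h0 := hpos 0 (by simp)
  set w := h 0 with hw
  have hden : ∀ z ∈ Metric.ball (0 : ℂ) 1, h z + (starRingEnd ℂ) w ≠ 0 := fun z hz H => by
    have := congrArg Complex.re H
    simp at this
    linarith [hpos z hz]
  have hda : DifferentiableAt ℂ h 0 := hd.differentiableAt (Metric.ball_mem_nhds _ one_pos)
  -- The Cayley transform sending `w` to `0` reduces to the Schwarz lemma for the disc; its
  -- derivative at `w` is `1 / (2 Re w)`.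
  have hφ : DifferentiableOn ℂ (fun z => (h z - w) / (h z + (starRingEnd ℂ) w)) (Metric.ball 0 1) :=
    (hd.sub_const _).div (hd.add_const _) hden
  have hmaps : MapsTo (fun z => (h z - w) / (h z + (starRingEnd ℂ) w)) (Metric.ball 0 1)
      (Metric.closedBall ((h 0 - w) / (h 0 + (starRingEnd ℂ) w)) 1) := by
    intro z hz
    rw [← hw, sub_self, zero_div, mem_closedBall_zero_iff, norm_div]
    refine div_le_one_of_le₀ ?_ (norm_nonneg _)
    refine le_of_sq_le_sq ?_ (norm_nonneg _)
    rw [← Complex.normSq_eq_norm_sq, ← Complex.normSq_eq_norm_sq, Complex.normSq_apply,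
      Complex.normSq_apply]
    simp
    nlinarith [mul_pos (hpos z hz) h0]
  have key := Complex.norm_deriv_le_div_of_mapsTo_ball hφ hmaps one_pos
  have hder : HasDerivAt (fun z => (h z - w) / (h z + (starRingEnd ℂ) w))
      ((deriv h 0 * (h 0 + (starRingEnd ℂ) w) - (h 0 - w) * deriv h 0) /
        (h 0 + (starRingEnd ℂ) w) ^ 2) 0 :=
    (hda.hasDerivAt.sub_const w).div (hda.hasDerivAt.add_const _) (hden 0 (by simp))
  have hsum : w + (starRingEnd ℂ) w = ((2 * w.re : ℝ) : ℂ) := Complex.add_conj w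
  rw [hder.deriv, ← hw, sub_self, zero_mul, sub_zero, hsum, norm_div, norm_mul, norm_pow,
    Complex.norm_real, Real.norm_of_nonneg (by positivity), div_one, pow_two,
    mul_div_mul_right _ _ (by positivity), div_le_one (by positivity)] at key
  exact key

/-- Composing a disc in `Ω` with `z ↦ c - f z` gives a disc in the right half-plane, where the
Schwarz lemma applies. -/
theorem norm_le_mul_kobayashiMetric (hΩ : IsOpen Ω) {x v : E} (hx : x ∈ Ω) {f : E →L[ℂ] ℂ} {c : ℂ}
    (hf : ∀ z ∈ Ω, 0 < (c - f z).re) : ‖f v‖ ≤ 2 * (c - f x).re * kobayashiMetric Ω x v := by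
  have hpos := hf x hx
  rw [← div_le_iff₀' (by positivity)]
  refine le_csInf ?_ ?_
  -- `le_csInf` requires some competing disc; openness of `Ω` provides a small affine one.
  · obtain ⟨ρ, hρ, hsub⟩ := Metric.isOpen_iff.1 hΩ x hx
    refine ⟨_, ((2 * ‖v‖ / ρ : ℝ) : ℂ), fun z : ℂ => x + ((ρ / (2 * ‖v‖) : ℝ) : ℂ) • z • v, by fun_prop,
      ?_, by simp, ?_, rfl⟩
    · intro z hz
      have hz' : ‖z‖ < 1 := by simpa using hz
      apply hsub
      rw [mem_ball_iff_norm, add_sub_cancel_left, norm_smul, norm_smul,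
        Complex.norm_real, Real.norm_of_nonneg (by positivity)]
      rcases eq_or_ne ‖v‖ 0 with h0 | h0
      · simpa [h0] using hρ
      · calc ρ / (2 * ‖v‖) * (‖z‖ * ‖v‖) = ρ * ‖z‖ / 2 := by field_simp
          _ < ρ := by nlinarith
    · have : HasDerivAt (fun z : ℂ => x + ((ρ / (2 * ‖v‖) : ℝ) : ℂ) • z • v)
          (((ρ / (2 * ‖v‖) : ℝ) : ℂ) • (1 : ℂ) • v) 0 :=
        ((((hasDerivAt_id (0 : ℂ)).smul_const v).const_smul _).const_add x)
      rw [this.deriv, one_smul, smul_smul]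
      rcases eq_or_ne v 0 with h0 | h0
      · simp [h0]
      · have : ‖v‖ ≠ 0 := norm_ne_zero_iff.2 h0
        rw [← Complex.ofReal_mul, div_mul_div_comm, mul_comm ρ, div_self (by positivity)]
        simp
  · rintro _ ⟨ξ, g, hg, hm, rfl, rfl, rfl⟩
    have hga : DifferentiableAt ℂ g 0 := hg.differentiableAt (Metric.ball_mem_nhds _ one_pos)
    have hder : HasDerivAt (fun z => c - f (g z)) (-(f (deriv g 0))) 0 :=
      (f.hasFDerivAt.comp_hasDerivAt (0 : ℂ) hga.hasDerivAt).const_sub c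
    have := norm_deriv_le_of_re_pos (h := fun z => c - f (g z))
      ((f.differentiable.comp_differentiableOn hg).const_sub c) (fun z hz => hf _ (hm hz))
    rw [hder.deriv, norm_neg] at this
    rw [div_le_iff₀ (by positivity), map_smul, norm_smul]
    gcongr

theorem kobayashiMetric_smul (Ω : Set E) (x v : E) {a : ℝ} (ha : a ≠ 0) :
    kobayashiMetric Ω x (a • v) = |a| * kobayashiMetric Ω x v := by
  rw [kobayashiMetric, kobayashiMetric, ← smul_eq_mul, ← Real.sInf_smul_of_nonneg (abs_nonneg a)]
  congr 1
  ext s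
  rw [mem_smul_set]
  have ha' : (a : ℂ) ≠ 0 := by exact_mod_cast ha
  constructor
  · rintro ⟨ξ, f, hf, hm, h0, hv, rfl⟩
    refine ⟨_, ⟨(a : ℂ)⁻¹ * ξ, f, hf, hm, h0, ?_, rfl⟩, ?_⟩
    · rw [mul_smul, hv, ← Complex.coe_smul a v, smul_smul, inv_mul_cancel₀ ha', one_smul]
    · rw [norm_mul, norm_inv, Complex.norm_real, smul_eq_mul, Real.norm_eq_abs,
        mul_inv_cancel_left₀ (abs_ne_zero.2 ha)]
  · rintro ⟨_, ⟨ξ, f, hf, hm, h0, hv, rfl⟩, rfl⟩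
    refine ⟨(a : ℂ) * ξ, f, hf, hm, h0, ?_, ?_⟩
    · rw [mul_smul, hv, Complex.coe_smul]
    · rw [norm_mul, Complex.norm_real, smul_eq_mul, Real.norm_eq_abs]

/-! ### The Kobayashi distance: triangle inequality, segments, half-plane bound. -/

/-- The Kobayashi distance with values in `[0, ∞]`. -/
noncomputable def kobayashiEDist (Ω : Set E) (x y : E) : ℝ≥0∞ :=
  ⨅ (γ : ℝ → E) (_ : IsPiecewiseC1Curve Ω x y γ), kobayashiLength Ω γ

theorem kobayashiDist_eq_toReal (Ω : Set E) (x y : E) :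
    kobayashiDist Ω x y = (kobayashiEDist Ω x y).toReal := rfl

theorem kobayashiDist_nonneg (Ω : Set E) (x y : E) : 0 ≤ kobayashiDist Ω x y :=
  ENNReal.toReal_nonneg

/-- Homogeneity of the metric turns the chain-rule factor into the Jacobian. Neither measurability
of the metric nor differentiability of `γ` is involved. -/
theorem lintegral_kobayashiMetric_comp_affine (Ω : Set E) (γ : ℝ → E) {k c : ℝ} (hk : k ≠ 0)
    {s : Set ℝ} (hs : MeasurableSet s) :
    ∫⁻ t in s, ENNReal.ofReal
        (kobayashiMetric Ω (γ (k * t + c)) (deriv (fun t => γ (k * t + c)) t)) =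
      ∫⁻ t in (fun t => k * t + c) '' s, ENNReal.ofReal (kobayashiMetric Ω (γ t) (deriv γ t)) := by
  rw [lintegral_image_eq_lintegral_abs_deriv_mul (f' := fun _ => k) hs]
  · refine lintegral_congr fun t => ?_
    have : deriv (fun t => γ (k * t + c)) t = k • deriv γ (k * t + c) := by
      rw [deriv_comp_mul_left k (fun t => γ (t + c)), deriv_comp_add_const]
    rw [this, kobayashiMetric_smul _ _ _ hk, ENNReal.ofReal_mul (abs_nonneg _)]
  · intro x _
    simpa using (((hasDerivAt_id x).const_mul k).add_const c).hasDerivWithinAt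
  · intro x _ y _ h
    exact mul_left_cancel₀ hk (add_right_cancel h)

theorem IsPiecewiseC1Curve.reverse {x y : E} {γ : ℝ → E} (h : IsPiecewiseC1Curve Ω x y γ) :
    IsPiecewiseC1Curve Ω y x (fun t => γ (-1 * t + 1)) := by
  have hmaps : ∀ t ∈ Icc (0 : ℝ) 1, -1 * t + 1 ∈ Icc (0 : ℝ) 1 := fun t ht =>
    ⟨by linarith [ht.2], by linarith [ht.1]⟩
  refine ⟨h.continuousOn.comp (by fun_prop) hmaps, ?_, h.mapsTo.comp hmaps, by simpa using h.target,
    by simpa using h.source⟩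
  obtain ⟨N, t, hmono, h0, hN, hC⟩ := h.piecewise
  refine ⟨N, fun i => -1 * t (N - i) + 1, fun i j hij => ?_, by simp [hN], by simp [h0],
    fun i hi => ?_⟩
  · have := hmono (Nat.sub_le_sub_left hij N)
    linarith
  · have hsub : N - (i + 1) < N := by omega
    refine (hC _ hsub).comp (by fun_prop) fun s hs => ?_
    have : N - (i + 1) + 1 = N - i := by omega
    rw [this]
    exact ⟨by linarith [hs.2], by linarith [hs.1]⟩

theorem kobayashiLength_reverse (Ω : Set E) (γ : ℝ → E) :
    kobayashiLength Ω (fun t => γ (-1 * t + 1)) = kobayashiLength Ω γ := by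
  rw [kobayashiLength, lintegral_kobayashiMetric_comp_affine Ω γ (by norm_num) measurableSet_Icc,
    kobayashiLength]
  have : (fun t : ℝ => -1 * t + 1) = fun t => 1 - t := by ext; ring
  rw [this, image_const_sub_Icc]
  norm_num

theorem kobayashiEDist_comm (Ω : Set E) (x y : E) : kobayashiEDist Ω x y = kobayashiEDist Ω y x := by
  have : ∀ x y, kobayashiEDist Ω x y ≤ kobayashiEDist Ω y x := fun x y =>
    le_iInf₂ fun γ hγ => (iInf₂_le _ hγ.reverse).trans_eq (kobayashiLength_reverse Ω γ)
  exact le_antisymm (this x y) (this y x)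

theorem kobayashiDist_comm (Ω : Set E) (x y : E) : kobayashiDist Ω x y = kobayashiDist Ω y x := by
  rw [kobayashiDist_eq_toReal, kobayashiEDist_comm, kobayashiDist_eq_toReal]

/-- Concatenation of two curves parametrised by `[0, 1]`. -/
noncomputable def concatCurve {F : Type*} (γ₁ γ₂ : ℝ → F) (t : ℝ) : F :=
  if t ≤ 1 / 2 then γ₁ (2 * t + 0) else γ₂ (2 * t + -1)

theorem concatCurve_eqOn_left {F : Type*} (γ₁ γ₂ : ℝ → F) :
    EqOn (concatCurve γ₁ γ₂) (fun t => γ₁ (2 * t + 0)) (Iic (1 / 2)) := fun _ ht => if_pos ht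

theorem concatCurve_eqOn_right {F : Type*} {γ₁ γ₂ : ℝ → F} (h : γ₁ 1 = γ₂ 0) :
    EqOn (concatCurve γ₁ γ₂) (fun t => γ₂ (2 * t + -1)) (Ici (1 / 2)) := fun t ht => by
  rcases eq_or_lt_of_le (mem_Ici.1 ht) with rfl | h'
  · rw [concatCurve, if_pos le_rfl]; norm_num [h]
  · exact if_neg (not_le.2 h')

theorem IsPiecewiseC1Curve.concat {x y z : E} {γ₁ γ₂ : ℝ → E} (h₁ : IsPiecewiseC1Curve Ω x y γ₁)
    (h₂ : IsPiecewiseC1Curve Ω y z γ₂) : IsPiecewiseC1Curve Ω x z (concatCurve γ₁ γ₂) := by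
  have hl := concatCurve_eqOn_left γ₁ γ₂
  have hr := concatCurve_eqOn_right (h₁.target.trans h₂.source.symm)
  have hI : Icc (0 : ℝ) 1 = Icc 0 (1 / 2) ∪ Icc (1 / 2) 1 :=
    (Icc_union_Icc_eq_Icc (by norm_num) (by norm_num)).symm
  have hm1 : ∀ t ∈ Icc (0 : ℝ) (1 / 2), 2 * t + 0 ∈ Icc (0 : ℝ) 1 := fun t ht =>
    ⟨by linarith [ht.1], by linarith [ht.2]⟩
  have hm2 : ∀ t ∈ Icc (1 / 2 : ℝ) 1, 2 * t + -1 ∈ Icc (0 : ℝ) 1 := fun t ht =>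
    ⟨by linarith [ht.1], by linarith [ht.2]⟩
  refine ⟨?_, ?_, ?_, ?_, ?_⟩
  · rw [hI]
    refine ContinuousOn.union_of_isClosed ?_ ?_ isClosed_Icc isClosed_Icc
    · exact (h₁.continuousOn.comp (by fun_prop) hm1).congr (hl.mono fun t ht => ht.2)
    · exact (h₂.continuousOn.comp (by fun_prop) hm2).congr (hr.mono fun t ht => ht.1)
  · obtain ⟨N₁, t₁, hmono₁, h0₁, hN₁, hC₁⟩ := h₁.piecewise
    obtain ⟨N₂, t₂, hmono₂, h0₂, hN₂, hC₂⟩ := h₂.piecewise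
    have hlow : ∀ i, i ≤ N₁ → (if i ≤ N₁ then t₁ i / 2 else (1 + t₂ (i - N₁)) / 2) = t₁ i / 2 :=
      fun i hi => if_pos hi
    -- At `i = N₁` the two formulas agree, both giving `1 / 2`.
    have hhigh : ∀ i, N₁ ≤ i →
        (if i ≤ N₁ then t₁ i / 2 else (1 + t₂ (i - N₁)) / 2) = (1 + t₂ (i - N₁)) / 2 := fun i hi => by
      rcases eq_or_lt_of_le hi with rfl | h
      · simp [h0₂, hN₁]
      · exact if_neg (not_le.2 h)
    refine ⟨N₁ + N₂, fun i => if i ≤ N₁ then t₁ i / 2 else (1 + t₂ (i - N₁)) / 2,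
      monotone_nat_of_le_succ fun i => ?_, ?_, ?_, fun i hi => ?_⟩
    · rcases Nat.lt_or_ge i N₁ with h | h
      · rw [hlow i h.le, hlow (i + 1) h]
        linarith [hmono₁ (Nat.le_succ i)]
      · rw [hhigh i h, hhigh (i + 1) (by omega)]
        linarith [hmono₂ (Nat.sub_le_sub_right (Nat.le_succ i) N₁)]
    · simp [h0₁]
    · simp only
      rw [hhigh _ (by omega), Nat.add_sub_cancel_left, hN₂]; norm_num
    · rcases Nat.lt_or_ge i N₁ with h | h
      · simp only
        rw [hlow i h.le, hlow (i + 1) h]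
        have hle : t₁ (i + 1) ≤ 1 := hN₁ ▸ hmono₁ h
        refine ContDiffOn.congr ((hC₁ i h).comp (by fun_prop) fun s hs => ?_)
          (hl.mono fun s hs => ?_)
        · exact ⟨by linarith [hs.1], by linarith [hs.2]⟩
        · exact mem_Iic.2 (by linarith [hs.2])
      · simp only
        rw [hhigh i h, hhigh (i + 1) (by omega)]
        have hge : 0 ≤ t₂ (i - N₁) := h0₂ ▸ hmono₂ (Nat.zero_le _)
        refine ContDiffOn.congr ((hC₂ (i - N₁) (by omega)).comp (by fun_prop) fun s hs => ?_)
          (hr.mono fun s hs => ?_)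
        · rw [← Nat.sub_add_comm h]
          exact ⟨by linarith [hs.1], by linarith [hs.2]⟩
        · exact mem_Ici.2 (by linarith [hs.1])
  · intro t ht
    rw [hI] at ht
    rcases ht with ht | ht
    · rw [hl ht.2]; exact h₁.mapsTo (hm1 t ht)
    · rw [hr ht.1]; exact h₂.mapsTo (hm2 t ht)
  · rw [hl (by norm_num)]; simpa using h₁.source
  · rw [hr (by norm_num)]; norm_num [h₂.target]

theorem kobayashiLength_concat_le (Ω : Set E) {γ₁ γ₂ : ℝ → E} :
    kobayashiLength Ω (concatCurve γ₁ γ₂) ≤ kobayashiLength Ω γ₁ + kobayashiLength Ω γ₂ := by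
  have hI : Icc (0 : ℝ) 1 = Icc 0 (1 / 2) ∪ Icc (1 / 2) 1 :=
    (Icc_union_Icc_eq_Icc (by norm_num) (by norm_num)).symm
  rw [kobayashiLength, hI]
  refine (lintegral_union_le _ _ _).trans (add_le_add ?_ ?_)
  · have : ∫⁻ t in Icc (0 : ℝ) (1 / 2), ENNReal.ofReal
        (kobayashiMetric Ω (concatCurve γ₁ γ₂ t) (deriv (concatCurve γ₁ γ₂) t)) =
        ∫⁻ t in Icc (0 : ℝ) (1 / 2), ENNReal.ofReal
        (kobayashiMetric Ω (γ₁ (2 * t + 0)) (deriv (fun t => γ₁ (2 * t + 0)) t)) := by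
      -- At `1 / 2` the concatenation may have a corner; on the open interval it agrees locally with
      -- the rescaled piece.
      rw [← restrict_Ioo_eq_restrict_Icc]
      refine setLIntegral_congr_fun measurableSet_Ioo fun t ht => ?_
      have he : concatCurve γ₁ γ₂ =ᶠ[nhds t] fun t => γ₁ (2 * t + 0) :=
        (concatCurve_eqOn_left γ₁ γ₂).eventuallyEq_of_mem (Iic_mem_nhds ht.2)
      simp only [he.deriv_eq, he.self_of_nhds]
    -- The `+ 0` in `concatCurve` makes this an instance of the affine substitution.
    rw [this, lintegral_kobayashiMetric_comp_affine Ω γ₁ two_ne_zero measurableSet_Icc,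
      image_affine_Icc' two_pos, kobayashiLength]
    norm_num
  · have : ∫⁻ t in Icc (1 / 2 : ℝ) 1, ENNReal.ofReal
        (kobayashiMetric Ω (concatCurve γ₁ γ₂ t) (deriv (concatCurve γ₁ γ₂) t)) =
        ∫⁻ t in Icc (1 / 2 : ℝ) 1, ENNReal.ofReal
        (kobayashiMetric Ω (γ₂ (2 * t + -1)) (deriv (fun t => γ₂ (2 * t + -1)) t)) := by
      rw [← restrict_Ioo_eq_restrict_Icc]
      refine setLIntegral_congr_fun measurableSet_Ioo fun t ht => ?_
      have he : concatCurve γ₁ γ₂ =ᶠ[nhds t] fun t => γ₂ (2 * t + -1) := by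
        filter_upwards [Ioi_mem_nhds ht.1] with s hs
        exact if_neg (not_le.2 hs)
      simp only [he.deriv_eq, he.self_of_nhds]
    rw [this, lintegral_kobayashiMetric_comp_affine Ω γ₂ two_ne_zero measurableSet_Icc,
      image_affine_Icc' two_pos, kobayashiLength]
    norm_num

theorem kobayashiEDist_triangle (Ω : Set E) (x y z : E) :
    kobayashiEDist Ω x z ≤ kobayashiEDist Ω x y + kobayashiEDist Ω y z := by
  refine ENNReal.le_iInf₂_add_iInf₂ fun γ₁ h₁ γ₂ h₂ => ?_
  exact (iInf₂_le _ (h₁.concat h₂)).trans (kobayashiLength_concat_le Ω)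

/-- The metric along the segment is replaced by a continuous majorant with explicit primitive `g`,
so only the majorant is integrated. -/
theorem kobayashiEDist_segment_le {z v : E} {g g' : ℝ → ℝ}
    (hseg : ∀ t ∈ Icc (0 : ℝ) 1, z + t • v ∈ Ω)
    (hg : ∀ t ∈ Icc (0 : ℝ) 1, HasDerivAt g (g' t) t) (hc : ContinuousOn g' (Icc 0 1))
    (hK : ∀ t ∈ Icc (0 : ℝ) 1, kobayashiMetric Ω (z + t • v) v ≤ g' t) :
    kobayashiEDist Ω z (z + v) ≤ ENNReal.ofReal (g 1 - g 0) := by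
  have hcd : ContDiff ℝ 1 fun t : ℝ => z + t • v := by fun_prop
  have hγ : IsPiecewiseC1Curve Ω z (z + v) fun t => z + t • v :=
    ⟨hcd.continuous.continuousOn, ⟨1, fun i => if i = 0 then 0 else 1,
      monotone_nat_of_le_succ fun i => by rcases i with _ | i <;> simp, by simp, by simp,
      fun i _ => hcd.contDiffOn⟩, hseg, by simp, by simp⟩
  refine (iInf₂_le _ hγ).trans ?_
  have hd : ∀ t : ℝ, deriv (fun t : ℝ => z + t • v) t = v := fun t => by
    simpa using (((hasDerivAt_id t).smul_const v).const_add z).deriv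
  simp only [kobayashiLength, hd]
  have hu : uIcc (0 : ℝ) 1 = Icc 0 1 := uIcc_of_le zero_le_one
  have hint : IntervalIntegrable g' volume 0 1 := (hu ▸ hc).intervalIntegrable
  rw [← intervalIntegral.integral_eq_sub_of_hasDerivAt (hu ▸ hg) hint,
    intervalIntegral.integral_of_le zero_le_one, restrict_Ioc_eq_restrict_Icc,
    ofReal_integral_eq_lintegral_ofReal]
  · exact setLIntegral_mono' measurableSet_Icc fun t ht => ENNReal.ofReal_le_ofReal (hK t ht)
  · exact hc.integrableOn_Icc
  · refine (ae_restrict_iff' measurableSet_Icc).2 (Filter.Eventually.of_forall fun t ht => ?_)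
    exact (kobayashiMetric_nonneg _ _ _).trans (hK t ht)

/-- Lower bound for the Kobayashi distance from a map to a half-plane. -/
theorem norm_log_sub_log_le (hΩ : IsOpen Ω) {x y : E} {f : E →L[ℂ] ℂ} {c : ℂ}
    (hf : ∀ z ∈ Ω, 0 < (c - f z).re) :
    ‖Complex.log (c - f y) - Complex.log (c - f x)‖ₑ ≤ 2 * kobayashiEDist Ω x y := by
  rw [kobayashiEDist, ENNReal.mul_iInf_of_ne two_ne_zero (by simp)]
  refine le_iInf fun γ => ?_
  rw [ENNReal.mul_iInf_of_ne two_ne_zero (by simp)]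
  refine le_iInf fun hγ => ?_
  obtain ⟨N, t, hmono, h0, hN, hC⟩ := hγ.piecewise
  have hsl : ∀ s ∈ Icc (0 : ℝ) 1, c - f (γ s) ∈ Complex.slitPlane := fun s hs =>
    Or.inl (hf _ (hγ.mapsTo hs))
  have hIcc : ∀ i < N, Icc (t i) (t (i + 1)) ⊆ Icc 0 1 := fun i hi =>
    Icc_subset_Icc (h0 ▸ hmono (Nat.zero_le _)) (hN ▸ hmono hi)
  set F : ℝ → ℂ := fun s => Complex.log (c - f (γ s)) with hF
  set φ : ℝ → ℝ≥0∞ := fun s => 2 * ENNReal.ofReal (kobayashiMetric Ω (γ s) (deriv γ s)) with hφ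
  -- `F' = -f(γ') / (c - f γ)`, and the half-plane bound with `Re ≤ |·|` gives `|F'| ≤ 2K`.
  -- Differentiability of `γ` is known only inside each partition interval.
  have hpiece : ∀ i < N, ‖F (t (i + 1)) - F (t i)‖ₑ ≤ ∫⁻ s in Icc (t i) (t (i + 1)), φ s := by
    intro i hi
    have hle : t i ≤ t (i + 1) := hmono (Nat.le_succ i)
    have hCF : ContDiffOn ℝ 1 F (Icc (t i) (t (i + 1))) := by
      intro s hs
      have h1 : ContDiffWithinAt ℝ 1 (fun s => c - f (γ s)) (Icc (t i) (t (i + 1))) s :=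
        contDiffWithinAt_const.sub
          ((f.restrictScalars ℝ).contDiff.contDiffAt.comp_contDiffWithinAt s (hC i hi s hs))
      exact ((Complex.contDiffAt_log (hsl s (hIcc i hi hs))).restrict_scalars
        ℝ).comp_contDiffWithinAt s h1
    refine (enorm_sub_le_lintegral_deriv_of_contDiffOn_Icc hCF hle).trans ?_
    rw [← restrict_Ioo_eq_restrict_Icc]
    refine setLIntegral_mono' measurableSet_Ioo fun s hs => ?_
    have hs' := hIcc i hi (Ioo_subset_Icc_self hs)
    have hmem := hγ.mapsTo hs'
    have hdγ : HasDerivAt γ (deriv γ s) s :=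
      (((hC i hi s (Ioo_subset_Icc_self hs)).contDiffAt (Icc_mem_nhds hs.1 hs.2)).differentiableAt
        one_ne_zero).hasDerivAt
    have h2 : HasDerivAt F (-(f (deriv γ s)) / (c - f (γ s))) s :=
      (((f.restrictScalars ℝ).hasFDerivAt.comp_hasDerivAt s hdγ).const_sub c).clog_real (hsl s hs')
    have hpos := hf _ hmem
    have hre : (c - f (γ s)).re ≤ ‖c - f (γ s)‖ := Complex.re_le_norm _
    have hK := kobayashiMetric_nonneg Ω (γ s) (deriv γ s)
    have hφs : φ s = ENNReal.ofReal (2 * kobayashiMetric Ω (γ s) (deriv γ s)) := by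
      rw [ENNReal.ofReal_mul zero_le_two, ENNReal.ofReal_ofNat]
    rw [h2.deriv, hφs, ← ofReal_norm, norm_div, norm_neg]
    refine ENNReal.ofReal_le_ofReal ?_
    rw [div_le_iff₀ (hpos.trans_le hre)]
    calc ‖f (deriv γ s)‖ ≤ 2 * (c - f (γ s)).re * kobayashiMetric Ω (γ s) (deriv γ s) :=
          norm_le_mul_kobayashiMetric hΩ hmem hf
      _ = 2 * kobayashiMetric Ω (γ s) (deriv γ s) * (c - f (γ s)).re := by ring
      _ ≤ _ := by gcongr
  have hsum : ∀ i ≤ N, ‖F (t i) - F (t 0)‖ₑ ≤ ∫⁻ s in Icc (t 0) (t i), φ s := by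
    intro i
    induction i with
    | zero => simp
    | succ i ih =>
      intro hi
      have hsplit : Icc (t 0) (t (i + 1)) = Icc (t 0) (t i) ∪ Ioc (t i) (t (i + 1)) :=
        (Icc_union_Ioc_eq_Icc (hmono (Nat.zero_le _)) (hmono (Nat.le_succ i))).symm
      rw [hsplit, lintegral_union measurableSet_Ioc
        (Set.disjoint_left.2 fun s hs hs' => not_lt.2 hs.2 hs'.1), restrict_Ioc_eq_restrict_Icc]
      calc ‖F (t (i + 1)) - F (t 0)‖ₑ = ‖(F (t i) - F (t 0)) + (F (t (i + 1)) - F (t i))‖ₑ := by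
            congr 1; ring
        _ ≤ _ := enorm_add_le _ _
        _ ≤ _ := add_le_add (ih (by omega)) (hpiece i (by omega))
  have := hsum N le_rfl
  rw [h0, hN, hφ, lintegral_const_mul' _ _ (by simp), hF] at this
  simpa only [hγ.source, hγ.target, kobayashiLength] using this

/-! ### Boundary distance and Kobayashi distance on convex domains. -/

theorem inter_frontier_nonempty_of_isPreconnected {X : Type*} [TopologicalSpace X] {s U : Set X}
    (hU : IsOpen U) (hs : IsPreconnected s) (h1 : (s ∩ U).Nonempty) (h2 : (s ∩ Uᶜ).Nonempty) :
    (s ∩ frontier U).Nonempty := by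
  by_contra hne
  rw [not_nonempty_iff_eq_empty] at hne
  have hsub : s ⊆ U ∪ (closure U)ᶜ := fun z hz => by
    by_contra h
    simp only [mem_union, mem_compl_iff, not_or, not_not] at h
    have : z ∈ s ∩ frontier U := ⟨hz, by rw [hU.frontier_eq]; exact ⟨h.2, h.1⟩⟩
    simp [hne] at this
  have hdisj : Disjoint U (closure U)ᶜ := disjoint_compl_right.mono_left subset_closure
  obtain ⟨y, hy, hyU⟩ := h2
  exact hyU (hs.subset_left_of_subset_union hU isClosed_closure.isOpen_compl hdisj hsub h1 hy)

theorem ball_bdryDist_subset (hO : IsOpen Ω) {x : E} (hx : x ∈ Ω) :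
    Metric.ball x (bdryDist Ω x) ⊆ Ω := by
  intro y hy
  by_contra hyΩ
  have hpos : 0 < bdryDist Ω x := Metric.pos_of_mem_ball hy
  obtain ⟨z, hz, hzf⟩ := inter_frontier_nonempty_of_isPreconnected hO
    (convex_ball x (bdryDist Ω x)).isPreconnected ⟨x, Metric.mem_ball_self hpos, hx⟩ ⟨y, hy, hyΩ⟩
  exact Set.disjoint_left.1 Metric.disjoint_ball_infDist hz hzf

theorem le_bdryDist_of_ball_subset {E : Type*} [NormedAddCommGroup E] {Ω : Set E} (hO : IsOpen Ω) (hne : (frontier Ω).Nonempty) {x : E} {ρ : ℝ}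
    (h : Metric.ball x ρ ⊆ Ω) : ρ ≤ bdryDist Ω x := by
  refine (Metric.le_infDist hne).2 fun y hy => ?_
  by_contra hlt
  rw [hO.frontier_eq] at hy
  exact hy.2 (h (Metric.mem_ball'.2 (not_le.1 hlt)))

theorem bdryDist_pos {E : Type*} [NormedAddCommGroup E] {Ω : Set E} (hO : IsOpen Ω) (hne : (frontier Ω).Nonempty) {x : E} (hx : x ∈ Ω) :
    0 < bdryDist Ω x := by
  obtain ⟨ρ, hρ, h⟩ := Metric.isOpen_iff.1 hO x hx
  exact hρ.trans_le (le_bdryDist_of_ball_subset hO hne h)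

theorem bdryDist_le_add {E : Type*} [NormedAddCommGroup E] (Ω : Set E) (x y : E) : bdryDist Ω x ≤ bdryDist Ω y + ‖x - y‖ := by
  rw [← dist_eq_norm]; exact Metric.infDist_le_infDist_add_dist

theorem ball_segment_subset (hC : Convex ℝ Ω) {x y : E} {ρ t : ℝ} (ht : t ∈ Icc (0 : ℝ) 1)
    (hx : Metric.ball x ρ ⊆ Ω) (hy : Metric.ball y ρ ⊆ Ω) :
    Metric.ball (x + t • (y - x)) ρ ⊆ Ω := by
  intro w hw
  set u := w - (x + t • (y - x)) with hu
  have hun : ‖u‖ < ρ := mem_ball_iff_norm.1 hw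
  have h1 : x + u ∈ Ω := hx (by simpa [mem_ball_iff_norm] using hun)
  have h2 : y + u ∈ Ω := hy (by simpa [mem_ball_iff_norm] using hun)
  have := hC h1 h2 (sub_nonneg.2 ht.2) ht.1 (by ring)
  convert this using 1
  rw [hu]; module

theorem kobayashiEDist_le_norm_div (hC : Convex ℝ Ω) {x y : E} {ρ : ℝ} (hρ : 0 < ρ)
    (hx : Metric.ball x ρ ⊆ Ω) (hy : Metric.ball y ρ ⊆ Ω) :
    kobayashiEDist Ω x y ≤ ENNReal.ofReal (‖y - x‖ / ρ) := by
  have hsub : ∀ t ∈ Icc (0 : ℝ) 1, Metric.ball (x + t • (y - x)) ρ ⊆ Ω := fun t ht =>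
    ball_segment_subset hC ht hx hy
  have := kobayashiEDist_segment_le (Ω := Ω) (z := x) (v := y - x) (g := fun t => ‖y - x‖ / ρ * t)
    (g' := fun _ => ‖y - x‖ / ρ) (fun t ht => hsub t ht (Metric.mem_ball_self hρ))
    (fun t _ => by simpa using (hasDerivAt_id t).const_mul (‖y - x‖ / ρ)) continuousOn_const
    (fun t ht => kobayashiMetric_le_norm_div hρ (hsub t ht))
  simpa using this

theorem kobayashiEDist_ne_top (hO : IsOpen Ω) (hC : Convex ℝ Ω) {x y : E} (hx : x ∈ Ω)
    (hy : y ∈ Ω) : kobayashiEDist Ω x y ≠ ⊤ := by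
  obtain ⟨ρ₁, h1, hs1⟩ := Metric.isOpen_iff.1 hO x hx
  obtain ⟨ρ₂, h2, hs2⟩ := Metric.isOpen_iff.1 hO y hy
  exact ne_top_of_le_ne_top ENNReal.ofReal_ne_top
    (kobayashiEDist_le_norm_div hC (lt_min h1 h2)
      ((Metric.ball_subset_ball (min_le_left _ _)).trans hs1)
      ((Metric.ball_subset_ball (min_le_right _ _)).trans hs2))

theorem kobayashiDist_le_of_edist_le {x y : E} {b : ℝ} (hb : 0 ≤ b)
    (h : kobayashiEDist Ω x y ≤ ENNReal.ofReal b) : kobayashiDist Ω x y ≤ b :=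
  ENNReal.toReal_le_of_le_ofReal hb h

theorem kobayashiDist_le_norm_div (hC : Convex ℝ Ω) {x y : E} {ρ : ℝ} (hρ : 0 < ρ)
    (hx : Metric.ball x ρ ⊆ Ω) (hy : Metric.ball y ρ ⊆ Ω) :
    kobayashiDist Ω x y ≤ ‖y - x‖ / ρ :=
  kobayashiDist_le_of_edist_le (by positivity) (kobayashiEDist_le_norm_div hC hρ hx hy)

theorem kobayashiDist_self (hO : IsOpen Ω) (hC : Convex ℝ Ω) {x : E} (hx : x ∈ Ω) :
    kobayashiDist Ω x x = 0 := by
  obtain ⟨ρ, h, hs⟩ := Metric.isOpen_iff.1 hO x hx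
  exact le_antisymm (by simpa using kobayashiDist_le_norm_div hC h hs hs)
    (kobayashiDist_nonneg _ _ _)

theorem kobayashiDist_triangle (hO : IsOpen Ω) (hC : Convex ℝ Ω) {x y z : E} (hx : x ∈ Ω)
    (hy : y ∈ Ω) (hz : z ∈ Ω) :
    kobayashiDist Ω x z ≤ kobayashiDist Ω x y + kobayashiDist Ω y z := by
  simp only [kobayashiDist_eq_toReal]
  rw [← ENNReal.toReal_add (kobayashiEDist_ne_top hO hC hx hy) (kobayashiEDist_ne_top hO hC hy hz)]
  exact ENNReal.toReal_mono (ENNReal.add_ne_top.2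
    ⟨kobayashiEDist_ne_top hO hC hx hy, kobayashiEDist_ne_top hO hC hy hz⟩)
    (kobayashiEDist_triangle Ω x y z)

/-- A `ℂ`-affine map of the domain to the right half-plane bounds the Kobayashi distance below. -/
theorem norm_le_exp_kobayashiDist (hO : IsOpen Ω) (hC : Convex ℝ Ω) {x y : E} (hx : x ∈ Ω)
    (hy : y ∈ Ω) {f : E →L[ℂ] ℂ} {c : ℂ} (hf : ∀ z ∈ Ω, 0 < (c - f z).re) :
    ‖f (y - x)‖ ≤ ‖c - f x‖ * (Real.exp (2 * kobayashiDist Ω x y) - 1) := by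
  have hne : ∀ z ∈ Ω, c - f z ≠ 0 := fun z hz h => by simpa [h] using hf z hz
  have hlog : ‖Complex.log (c - f y) - Complex.log (c - f x)‖ ≤ 2 * kobayashiDist Ω x y := by
    have h := norm_log_sub_log_le hO (x := x) (y := y) hf
    have h2 := ENNReal.toReal_mono (ENNReal.mul_ne_top (by simp) (kobayashiEDist_ne_top hO hC hx hy)) h
    simpa [ENNReal.toReal_mul, kobayashiDist_eq_toReal] using h2
  set w := Complex.log (c - f y) - Complex.log (c - f x) with hw
  have hmul : c - f y = (c - f x) * Complex.exp w := by
    rw [hw, Complex.exp_sub, Complex.exp_log (hne y hy), Complex.exp_log (hne x hx),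
      mul_div_cancel₀ _ (hne x hx)]
  -- The exponential series without its constant term is dominated termwise.
  have hexp : ‖Complex.exp w - 1‖ ≤ Real.exp ‖w‖ - 1 := by
    simpa using Complex.norm_exp_sub_sum_le_exp_norm_sub_sum w 1
  have : f (y - x) = -((c - f x) * (Complex.exp w - 1)) := by
    rw [map_sub, mul_sub, ← hmul]; ring
  rw [this, norm_neg, norm_mul]
  gcongr
  exact hexp.trans (sub_le_sub_right (Real.exp_le_exp.2 hlog) _)

/-- Hahn–Banach at a boundary point; `z ↦ f ξ - f z` is the half-plane map behind the lower bounds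
for `d_K`. -/
theorem exists_supporting (hO : IsOpen Ω) (hC : Convex ℝ Ω) {ξ : E} (hξ : ξ ∈ frontier Ω) :
    ∃ f : E →L[ℂ] ℂ, ∀ z ∈ Ω, 0 < (f ξ - f z).re := by
  rw [hO.frontier_eq] at hξ
  obtain ⟨f, hf⟩ := RCLike.geometric_hahn_banach_open_point (𝕜 := ℂ) hC hO hξ.2
  refine ⟨f, fun z hz => ?_⟩
  have := hf z hz
  simp at this ⊢
  linarith

/-- If `‖f v‖` were too large for a unit `v`, moving from `x` along `a • v`, with the phase of `a`
making `a * f v` positive, would reach `Re (c - f) = 0` inside the ball. -/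
theorem mul_norm_le_re_of_ball_subset {f : E →L[ℂ] ℂ} {c : ℂ} {x : E} {ρ : ℝ} (hρ : 0 < ρ)
    (hx : Metric.ball x ρ ⊆ Ω) (hf : ∀ z ∈ Ω, 0 < (c - f z).re) : ‖f‖ * ρ ≤ (c - f x).re := by
  have hpos := hf x (hx (Metric.mem_ball_self hρ))
  rw [← le_div_iff₀ hρ]
  refine f.opNorm_le_of_unit_norm (by positivity) fun v hv => ?_
  by_contra hlt
  rw [not_le] at hlt
  have hfv : 0 < ‖f v‖ := (div_pos hpos hρ).trans hlt
  have hfv' : (‖f v‖ : ℂ) ≠ 0 := by exact_mod_cast hfv.ne'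
  set a : ℂ := (((c - f x).re / ‖f v‖ : ℝ) : ℂ) * ((starRingEnd ℂ) (f v) / ‖f v‖) with ha
  have hna : ‖a‖ = (c - f x).re / ‖f v‖ := by
    rw [ha, norm_mul, norm_div, Complex.norm_real, Complex.norm_real, RCLike.norm_conj, norm_norm,
      div_self hfv.ne', mul_one, Real.norm_of_nonneg (by positivity)]
  have hafv : a * f v = ((c - f x).re : ℂ) := by
    have hconj : (starRingEnd ℂ) (f v) * f v = (‖f v‖ : ℂ) ^ 2 := Complex.conj_mul' _
    calc a * f v = ((c - f x).re / ‖f v‖) * (((starRingEnd ℂ) (f v) * f v) / ‖f v‖) := by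
          rw [ha]; push_cast; ring
      _ = _ := by rw [hconj]; field_simp
  have hmem : x + a • v ∈ Ω := hx (by
    rw [mem_ball_iff_norm, add_sub_cancel_left, norm_smul, hv, mul_one, hna, div_lt_iff₀ hfv]
    rwa [div_lt_iff₀ hρ, mul_comm] at hlt)
  have := hf _ hmem
  rw [map_add, map_smul, smul_eq_mul, hafv, ← sub_sub, Complex.sub_re (c - f x), Complex.ofReal_re,
    sub_self] at this
  exact lt_irrefl _ this

/-- The boundary distance changes at most exponentially with the Kobayashi distance. -/
theorem bdryDist_le_mul_exp [ProperSpace E] (hO : IsOpen Ω) (hC : Convex ℝ Ω)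
    (hne : (frontier Ω).Nonempty) {x y : E} (hx : x ∈ Ω) (hy : y ∈ Ω) :
    bdryDist Ω x ≤ bdryDist Ω y * Real.exp (2 * kobayashiDist Ω x y) := by
  -- With `ξ` nearest to `y` and `f` supporting at `ξ`: `‖f‖ δ(x) ≤ |f(ξ - x)| ≤ |f(ξ - y)| exp(2d)
  -- ≤ ‖f‖ δ(y) exp(2d)`.
  obtain ⟨ξ, hξ, hdist⟩ := isClosed_frontier.exists_infDist_eq_dist hne y
  obtain ⟨f, hf⟩ := exists_supporting hO hC hξ
  have h1 := mul_norm_le_re_of_ball_subset (bdryDist_pos hO hne hx) (ball_bdryDist_subset hO hx) hf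
  have h2 := norm_le_exp_kobayashiDist hO hC hy hx hf
  rw [kobayashiDist_comm Ω y x] at h2
  have h3 : ‖f ξ - f y‖ ≤ ‖f‖ * bdryDist Ω y := by
    rw [← map_sub, bdryDist, hdist, dist_comm, dist_eq_norm]
    exact f.le_opNorm _
  have hfpos : 0 < ‖f‖ := by
    refine norm_pos_iff.2 fun h => ?_
    simpa [h] using hf x hx
  have h4 : ‖f ξ - f x‖ ≤ ‖f ξ - f y‖ + ‖f (x - y)‖ := by
    rw [map_sub]
    calc ‖f ξ - f x‖ = ‖(f ξ - f y) - (f x - f y)‖ := by congr 1; ring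
      _ ≤ _ := norm_sub_le _ _
  have h5 : (f ξ - f x).re ≤ ‖f ξ - f x‖ := Complex.re_le_norm _
  have h6 : ‖f‖ * bdryDist Ω x ≤ ‖f‖ * (bdryDist Ω y * Real.exp (2 * kobayashiDist Ω x y)) := by
    have := mul_le_mul_of_nonneg_right h3 (Real.exp_pos (2 * kobayashiDist Ω x y)).le
    linarith
  exact le_of_mul_le_mul_left h6 hfpos

/-- `Metric.infDist` to an empty set is `0`; this rules out that default in `bdryDistDir`. -/
theorem inter_line_nonempty [ProperSpace E] (hO : IsOpen Ω) (hB : Bornology.IsBounded Ω) {x v : E}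
    (hx : x ∈ Ω) (hv : v ≠ 0) : (frontier Ω ∩ range fun c : ℂ => x + c • v).Nonempty := by
  rw [inter_comm]
  refine inter_frontier_nonempty_of_isPreconnected hO
    (isPreconnected_range (by fun_prop)) ⟨x, ⟨0, by simp⟩, hx⟩ ?_
  obtain ⟨R, hR⟩ := hB.subset_ball x
  refine ⟨x + ((R / ‖v‖ : ℝ) : ℂ) • v, ⟨_, rfl⟩, fun h => ?_⟩
  have h' := hR h
  have hv' : ‖v‖ ≠ 0 := norm_ne_zero_iff.2 hv
  rw [mem_ball_iff_norm, add_sub_cancel_left, norm_smul, Complex.norm_real, Real.norm_eq_abs,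
    abs_div, abs_norm, div_mul_cancel₀ _ hv'] at h'
  exact absurd (le_abs_self R) (not_le.2 h')

/-- Let `ξ = x + a(y - x)` be a nearest boundary point on the complex line and `f` supporting at
`ξ`. Then `f ξ - f x = a f(y - x)`, so the half-plane bound contains `|f(y - x)|` on both sides;
cancelling it leaves `1 ≤ |a|(exp(2d) - 1)`. -/
theorem norm_sub_le_bdryDistDir_mul [ProperSpace E] (hO : IsOpen Ω) (hC : Convex ℝ Ω)
    (hB : Bornology.IsBounded Ω) {x y : E} (hx : x ∈ Ω) (hy : y ∈ Ω) (hxy : y - x ≠ 0) :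
    ‖y - x‖ ≤ bdryDistDir Ω x (y - x) * (Real.exp (2 * kobayashiDist Ω x y) - 1) := by
  have hcl : IsClosed (frontier Ω ∩ range fun c : ℂ => x + c • (y - x)) := by
    refine isClosed_frontier.inter ?_
    have : (range fun c : ℂ => x + c • (y - x)) =
        (fun z => z - x) ⁻¹' ((Submodule.span ℂ {y - x} : Submodule ℂ E) : Set E) := by
      ext z
      simp only [mem_range, mem_preimage, SetLike.mem_coe, Submodule.mem_span_singleton]
      exact exists_congr fun c => ⟨fun h => by rw [← h]; abel, fun h => by rw [h]; abel⟩
    rw [this]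
    exact (Submodule.closed_of_finiteDimensional _).preimage (by fun_prop)
  obtain ⟨ξ, ⟨hξ, a, ha⟩, hdist⟩ :=
    hcl.exists_infDist_eq_dist (inter_line_nonempty hO hB hx hxy) x
  simp only at ha
  obtain ⟨f, hf⟩ := exists_supporting hO hC hξ
  have h := norm_le_exp_kobayashiDist hO hC hx hy hf
  have hpos := hf x hx
  rw [← map_sub, ← ha, add_sub_cancel_left, map_smul] at hpos
  rw [← map_sub, ← ha, add_sub_cancel_left, map_smul, norm_smul] at h
  have hfpos : 0 < ‖f (y - x)‖ := by
    refine norm_pos_iff.2 fun h => ?_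
    simp [h] at hpos
  have hD : bdryDistDir Ω x (y - x) = ‖a‖ * ‖y - x‖ := by
    rw [bdryDistDir, hdist, ← ha, dist_self_add_right, norm_smul]
  have h1 : 1 ≤ ‖a‖ * (Real.exp (2 * kobayashiDist Ω x y) - 1) := by
    refine le_of_mul_le_mul_right ?_ hfpos
    linarith
  rw [hD]
  nlinarith [norm_nonneg (y - x)]

/-! ### The Dini condition at dyadic scales. -/

/-- By monotonicity, the integral of `f t / t` over `(2^{-k-1}, 2^{-k}]` is at least `f(2^{-k-1}) /
2`. -/
theorem summable_dyadic_of_integrableOn_div {f : ℝ → ℝ} (h0 : ∀ t, 0 ≤ f t)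
    (hmono : MonotoneOn f (Ioi 0)) (hint : IntegrableOn (fun t => f t / t) (Ioc 0 1)) :
    Summable fun k : ℕ => f ((1 / 2) ^ k) := by
  rw [← summable_nat_add_iff 1]
  set a : ℕ → ℝ := fun k => (1 / 2) ^ k with ha
  have hanti : Antitone a := pow_right_anti₀ (by norm_num) (by norm_num)
  have hapos : ∀ k, 0 < a k := fun k => by positivity
  have hsub : ∀ k, Ioc (a (k + 1)) (a k) ⊆ Ioc 0 1 := fun k =>
    Ioc_subset_Ioc (hapos _).le (pow_le_one₀ (by norm_num) (by norm_num))
  have hsum := (hasSum_integral_iUnion (f := fun t => f t / t) (μ := volume)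
    (s := fun k => Ioc (a (k + 1)) (a k)) (fun _ => measurableSet_Ioc)
    hanti.pairwise_disjoint_on_Ioc_succ (hint.mono_set (iUnion_subset hsub))).summable
  refine Summable.of_nonneg_of_le (fun k => h0 _) (fun k => ?_) (hsum.mul_left 2)
  have hle : ∫ _ in Ioc (a (k + 1)) (a k), f (a (k + 1)) / a k ≤
      ∫ t in Ioc (a (k + 1)) (a k), f t / t := by
    refine setIntegral_mono_on (integrableOn_const (by simp)) (hint.mono_set (hsub k))
      measurableSet_Ioc fun t ht => ?_
    have htpos : 0 < t := (hapos _).trans ht.1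
    exact div_le_div₀ (h0 t) (hmono (hapos _) htpos ht.1.le) htpos ht.2
  rw [setIntegral_const, Real.volume_real_Ioc_of_le (hanti (Nat.le_succ k)), smul_eq_mul] at hle
  have h1 : a (k + 1) = a k / 2 := by simp only [ha, pow_succ]; ring
  have h2 : (a k - a (k + 1)) * (f (a (k + 1)) / a k) = f (a (k + 1)) / 2 := by
    rw [h1]; field_simp [(hapos k).ne']; ring
  rw [h2] at hle
  linarith

/-- The recursion `w_{k+1} = w_k / 2 + ω_{k+1}` smooths `ω`. The ratio bounds let the depths `R_k
w_k`, with `R_k` halving, decrease by a factor between `1/4` and `3/4` per scale. -/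
theorem exists_summable_regular_majorant {ω : ℕ → ℝ} (hpos : ∀ k, 0 < ω k) (hanti : Antitone ω)
    (hsum : Summable ω) : ∃ w : ℕ → ℝ, (∀ k, ω k ≤ w k) ∧ Summable w ∧
      (∀ k, w k / 2 ≤ w (k + 1)) ∧ ∀ k, w (k + 1) ≤ 3 / 2 * w k := by
  let w : ℕ → ℝ := fun k => Nat.rec (ω 0) (fun k wk => wk / 2 + ω (k + 1)) k
  have hw0 : w 0 = ω 0 := rfl
  have hws : ∀ k, w (k + 1) = w k / 2 + ω (k + 1) := fun k => rfl
  clear_value w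
  have hwpos : ∀ k, 0 < w k := fun k => by
    induction k with
    | zero => exact hw0 ▸ hpos 0
    | succ k ih => rw [hws]; linarith [hpos (k + 1)]
  have hle : ∀ k, ω k ≤ w k := fun k => by
    cases k with
    | zero => exact hw0.ge
    | succ k => rw [hws]; linarith [hwpos k]
  refine ⟨w, hle, ?_, fun k => by rw [hws]; linarith [hpos (k + 1)],
    fun k => by rw [hws]; linarith [hanti (Nat.le_succ k), hle k]⟩
  have hpart : ∀ n, ∑ k ∈ Finset.range n, w k + 2 * w n = 2 * ∑ k ∈ Finset.range (n + 1), ω k := by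
    intro n
    induction n with
    | zero => simp [hw0]
    | succ n ih =>
      rw [Finset.sum_range_succ, Finset.sum_range_succ _ (n + 1), mul_add, ← ih, hws]; ring
  refine summable_of_sum_range_le (c := 2 * ∑' k, ω k) (fun k => (hwpos k).le) fun n => ?_
  have := hsum.sum_le_tsum (Finset.range (n + 1)) fun k _ => (hpos k).le
  linarith [hpart n, hwpos n]

/-! ### Normals, inner cones and balls, and the cost of moving along a normal. -/

theorem norm_sub_le_modulusOfContinuity {F : Type*} [NormedAddCommGroup F] {ν : F → F} {S : Set F}
    (hν : ∀ x ∈ S, ‖ν x‖ = 1) {x y : F} (hx : x ∈ S) (hy : y ∈ S) {t : ℝ} (hxy : ‖x - y‖ < t) :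
    ‖ν x - ν y‖ ≤ modulusOfContinuity ν S t := by
  refine le_csSup ⟨2, ?_⟩ ⟨x, hx, y, hy, hxy, rfl⟩
  rintro _ ⟨a, ha, b, hb, -, rfl⟩
  linarith [norm_sub_le (ν a) (ν b), hν a ha, hν b hb]

theorem modulusOfContinuity_nonneg {F : Type*} [NormedAddCommGroup F] (ν : F → F) (S : Set F)
    (t : ℝ) : 0 ≤ modulusOfContinuity ν S t :=
  Real.sSup_nonneg (by rintro _ ⟨a, -, b, -, -, rfl⟩; positivity)

theorem modulusOfContinuity_monotoneOn {F : Type*} [NormedAddCommGroup F] {ν : F → F} {S : Set F}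
    (hν : ∀ x ∈ S, ‖ν x‖ = 1) : MonotoneOn (modulusOfContinuity ν S) (Ioi 0) := by
  intro s _ t _ hst
  refine Real.sSup_le ?_ (modulusOfContinuity_nonneg _ _ _)
  rintro _ ⟨a, ha, b, hb, hab, rfl⟩
  exact norm_sub_le_modulusOfContinuity hν ha hb (hab.trans_le hst)

/-- On a convex domain, the outer unit normal given by a local defining function supports. -/
theorem re_inner_normal_nonpos (hO : IsOpen Ω) (hC : Convex ℝ Ω) {U : Set E} {r : E → ℝ}
    {ν : E → E} (hU : IsOpen U) (hr : IsLocalDefiningFunction Ω U r)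
    (hν : IsOuterUnitNormal Ω U r ν) {p x : E} (hp : p ∈ frontier Ω ∩ U) (hx : x ∈ Ω) :
    (inner ℂ (ν p) (x - p)).re ≤ 0 := by
  have hpΩ : p ∉ Ω := fun h => by
    have := hp.1; rw [hO.frontier_eq] at this; exact this.2 h
  have hrp : 0 ≤ r p := by
    by_contra h
    have : p ∈ Ω ∩ U := by rw [hr.inter_eq]; exact ⟨hp.2, not_le.1 h⟩
    exact hpΩ this.1
  have hder : HasDerivAt (fun s : ℝ => r (p + s • (x - p))) (fderiv ℝ r p (x - p)) 0 := by
    have h1 : HasFDerivAt r (fderiv ℝ r p) (p + (0 : ℝ) • (x - p)) := by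
      rw [zero_smul, add_zero]
      exact (((hr.contDiffOn p hp.2).contDiffAt (hU.mem_nhds hp.2)).differentiableAt
        one_ne_zero).hasFDerivAt
    have h2 : HasDerivAt (fun s : ℝ => p + s • (x - p)) (x - p) 0 := by
      simpa using ((hasDerivAt_id (0 : ℝ)).smul_const (x - p)).const_add p
    exact h1.comp_hasDerivAt (0 : ℝ) h2
  -- By convexity the segment from `p` towards `x` enters `Ω` at once, so `r`, nonnegative at `p`,
  -- is negative just after.
  have hle : fderiv ℝ r p (x - p) ≤ 0 := by
    have ht := (hasDerivWithinAt_iff_tendsto_slope' (by simp)).1 (hder.hasDerivWithinAt (s := Ioi 0))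
    refine le_of_tendsto ht ?_
    have hcont : Filter.Tendsto (fun s : ℝ => p + s • (x - p)) (nhdsWithin 0 (Ioi 0)) (nhds p) := by
      have : Continuous fun s : ℝ => p + s • (x - p) := by fun_prop
      simpa using (this.tendsto 0).mono_left nhdsWithin_le_nhds
    filter_upwards [hcont.eventually (hU.mem_nhds hp.2),
      Ioc_mem_nhdsGT (zero_lt_one (α := ℝ))] with s hsU hs
    have hmem : p + s • (x - p) ∈ Ω := by
      rw [← hO.interior_eq]
      exact hC.add_smul_mem_interior' (frontier_subset_closure hp.1)
        (by rwa [add_sub_cancel, hO.interior_eq]) hs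
    have hneg : r (p + s • (x - p)) < 0 := by
      have : p + s • (x - p) ∈ Ω ∩ U := ⟨hmem, hsU⟩
      rw [hr.inter_eq] at this
      exact this.2
    rw [slope_def_field]
    refine div_nonpos_of_nonpos_of_nonneg ?_ (by linarith [hs.1])
    simp only [zero_smul, add_zero]
    linarith
  rw [(hν p hp).2] at hle
  have : 0 < ‖fderiv ℝ r p‖ := norm_pos_iff.2 (hr.fderiv_ne_zero p hp.2)
  exact nonpos_of_mul_nonpos_right hle this

theorem re_inner_le_norm_mul_norm (x y : E) : (inner ℂ x y).re ≤ ‖x‖ * ‖y‖ :=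
  (Complex.re_le_norm _).trans (norm_inner_le_norm x y)

/-- Otherwise a segment from some `x₀ ∈ Ω` close to `p` to `p + w` leaves `Ω` at a boundary point
`q`. Its direction has nonnegative product with `ν q`, and `ν q` is `ω`-close to `ν p`, against the
cone condition on `w`. -/
theorem mem_of_re_inner_lt (hO : IsOpen Ω) {ν : E → E} {p w : E} {t ω : ℝ}
    (hp : p ∈ frontier Ω) (hunit : ∀ q ∈ frontier Ω ∩ Metric.ball p t, ‖ν q‖ = 1)
    (hsupp : ∀ q ∈ frontier Ω ∩ Metric.ball p t, ∀ x ∈ Ω, (inner ℂ (ν q) (x - q)).re ≤ 0)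
    (hω : ∀ q ∈ frontier Ω ∩ Metric.ball p t, ‖ν p - ν q‖ ≤ ω)
    (hwt : ‖w‖ < t) (hw : (inner ℂ (ν p) w).re < -(ω * ‖w‖)) : p + w ∈ Ω := by
  by_contra hz
  have ht : 0 < t := (norm_nonneg _).trans_lt hwt
  -- `g` is the slack in the cone condition; `x₀` closer to `p` than `g` makes its error harmless.
  set g := -(ω * ‖w‖) - (inner ℂ (ν p) w).re with hg
  have hgpos : 0 < g := by linarith
  obtain ⟨x₀, hx₀, hdist⟩ := Metric.mem_closure_iff.1 (frontier_subset_closure hp) (min g t)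
    (lt_min hgpos ht)
  rw [dist_comm, dist_eq_norm] at hdist
  obtain ⟨q, hq, hqf⟩ := inter_frontier_nonempty_of_isPreconnected hO
    (convex_segment x₀ (p + w)).isPreconnected ⟨x₀, left_mem_segment ℝ _ _, hx₀⟩
    ⟨_, right_mem_segment ℝ _ _, hz⟩
  have hqt : q ∈ Metric.ball p t := (convex_ball p t).segment_subset
    (mem_ball_iff_norm.2 (hdist.trans_le (min_le_right _ _)))
    (by simpa [mem_ball_iff_norm] using hwt) hq
  have hqΩ : q ∉ Ω := fun h => by
    rw [hO.frontier_eq] at hqf; exact hqf.2 h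
  rw [segment_eq_image'] at hq
  obtain ⟨θ, hθ, rfl⟩ := hq
  simp only at hqf hqt hqΩ
  set q := x₀ + θ • (p + w - x₀) with hqdef
  have hθpos : 0 < θ := by
    refine lt_of_le_of_ne hθ.1 fun h => hqΩ ?_
    rwa [hqdef, ← h, zero_smul, add_zero]
  have h1 : 0 ≤ (inner ℂ (ν q) (p + w - x₀)).re := by
    have h := hsupp q ⟨hqf, hqt⟩ x₀ hx₀
    have he : x₀ - q = (((-θ : ℝ) : ℂ)) • (p + w - x₀) := by
      rw [Complex.coe_smul, hqdef]; module
    rw [he, inner_smul_right, Complex.re_ofReal_mul] at h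
    nlinarith
  have h2 : (inner ℂ (ν q) (p - x₀)).re ≤ ‖x₀ - p‖ := by
    have := re_inner_le_norm_mul_norm (ν q) (p - x₀)
    rwa [hunit q ⟨hqf, hqt⟩, one_mul, norm_sub_rev] at this
  have h3 : (inner ℂ (ν q - ν p) w).re ≤ ω * ‖w‖ := by
    refine (re_inner_le_norm_mul_norm _ _).trans ?_
    rw [norm_sub_rev]
    exact mul_le_mul_of_nonneg_right (hω q ⟨hqf, hqt⟩) (norm_nonneg _)
  have h4 : p + w - x₀ = w + (p - x₀) := by abel
  rw [h4, inner_add_right, Complex.add_re] at h1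
  rw [inner_sub_left, Complex.sub_re] at h3
  have h5 := hdist.trans_le (min_le_left _ _)
  linarith

/-- For `w = u - R N`, `|u|² < R²(1 - ω²)` gives `2R Re⟨N,w⟩ < -(|w|² + R²ω²) ≤ -2Rω|w|`. The loss
of radius is quadratic in `ω`, hence of relative size `ω` at depth `Rω`. -/
theorem ball_subset_of_cone {p N : E} {t ω R : ℝ} (hN : ‖N‖ = 1) (hω0 : 0 ≤ ω) (hω1 : ω ≤ 1)
    (hR : 0 < R) (hRt : 2 * R ≤ t)
    (hcone : ∀ w : E, ‖w‖ < t → (inner ℂ N w).re < -(ω * ‖w‖) → p + w ∈ Ω) :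
    Metric.ball (p - R • N) (R * (1 - ω ^ 2)) ⊆ Ω := by
  intro z hz
  rw [mem_ball_iff_norm] at hz
  set u := z - (p - R • N) with hu
  have hzw : z = p + (u - R • N) := by rw [hu]; abel
  have hRN : ‖R • N‖ = R := by rw [norm_smul, hN, Real.norm_of_nonneg hR.le, mul_one]
  have hω2 : 0 ≤ 1 - ω ^ 2 := by nlinarith
  have huR : ‖u‖ < R := hz.trans_le (by nlinarith [sq_nonneg ω])
  rw [hzw]
  set w := u - R • N with hw
  refine hcone w ?_ ?_
  · linarith [norm_sub_le u (R • N)]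
  · have huw : ‖u‖ ^ 2 = ‖w‖ ^ 2 + 2 * R * (inner ℂ N w).re + R ^ 2 := by
      have : u = R • N + w := by rw [hw]; abel
      rw [this, norm_add_sq (𝕜 := ℂ), hRN, ← Complex.coe_smul, inner_smul_left]
      simp
      ring
    have h1 : ‖u‖ ^ 2 < R ^ 2 * (1 - ω ^ 2) := by
      calc ‖u‖ ^ 2 < (R * (1 - ω ^ 2)) ^ 2 := by gcongr
        _ = R ^ 2 * (1 - ω ^ 2) * (1 - ω ^ 2) := by ring
        _ ≤ R ^ 2 * (1 - ω ^ 2) * 1 := by gcongr; nlinarith [sq_nonneg ω]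
        _ = _ := mul_one _
    have h2 : R * (inner ℂ N w).re < R * (-(ω * ‖w‖)) := by
      nlinarith [sq_nonneg (‖w‖ - R * ω)]
    exact lt_of_mul_lt_mul_left h2 hR.le

theorem kobayashiEDist_self (hC : Convex ℝ Ω) {x : E} {ρ : ℝ} (hρ : 0 < ρ)
    (h : Metric.ball x ρ ⊆ Ω) : kobayashiEDist Ω x x = 0 := by
  simpa using kobayashiEDist_le_norm_div hC hρ h h

theorem neg_log_one_sub_le {x : ℝ} (h0 : 0 ≤ x) (h1 : x ≤ 1 / 2) : -Real.log (1 - x) ≤ 2 * x := by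
  have h := Real.one_sub_inv_le_log_of_pos (x := 1 - x) (by linarith)
  have h2 : (1 - x)⁻¹ ≤ 1 + 2 * x := by
    rw [inv_le_iff_one_le_mul₀ (by linarith)]
    nlinarith
  linarith

/-- Kobayashi distance of two points on a diameter of a ball of radius `ρ` contained in `Ω`, which
lie at distance `R - s`, `R - s'` from the centre `p - R N`. -/
theorem kobayashiEDist_diameter_le {p N : E} {R ρ s s' : ℝ} (hN : ‖N‖ = 1) (hρ : 0 < ρ)
    (hsub : Metric.ball (p - R • N) ρ ⊆ Ω) (hs : R - ρ < s) (hss' : s ≤ s') (hs' : s' ≤ R) :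
    kobayashiEDist Ω (p - s • N) (p - s' • N) ≤
      ENNReal.ofReal (1 / 2 * (Real.log (s' - (R - ρ)) - Real.log (s - (R - ρ))) +
        1 / 2 * (Real.log (ρ + R - s) - Real.log (ρ + R - s'))) := by
  set σ : ℝ → ℝ := fun t => s + (s' - s) * t with hσ
  have hσm : ∀ t ∈ Icc (0 : ℝ) 1, s ≤ σ t ∧ σ t ≤ R := fun t ht => by
    constructor <;> simp only [hσ] <;> nlinarith [ht.1, ht.2]
  have hσd : ∀ t, HasDerivAt σ (s' - s) t := fun t => by
    simpa [hσ] using ((hasDerivAt_id t).const_mul (s' - s)).const_add s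
  have hpt : ∀ t, p - s • N + t • ((s - s') • N) = p - R • N + (ρ * ((R - σ t) / ρ)) • N := fun t => by
    rw [mul_div_cancel₀ _ hρ.ne', hσ]; module
  have hu : ∀ t ∈ Icc (0 : ℝ) 1, |(R - σ t) / ρ| < 1 := fun t ht => by
    have := hσm t ht
    rw [abs_of_nonneg (div_nonneg (by linarith) hρ.le), div_lt_one hρ]
    linarith
  have hseg : ∀ t ∈ Icc (0 : ℝ) 1, p - s • N + t • ((s - s') • N) ∈ Ω := fun t ht => by
    apply hsub
    rw [hpt, mem_ball_iff_norm, add_sub_cancel_left, norm_smul, hN, mul_one, norm_mul,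
      Real.norm_of_nonneg hρ.le, Real.norm_eq_abs]
    nlinarith [hu t ht]
  -- `g'` is the Poincaré density of the diameter in partial fractions.
  have h := kobayashiEDist_segment_le (Ω := Ω) (z := p - s • N) (v := (s - s') • N)
    (g := fun t => 1 / 2 * (Real.log (σ t - (R - ρ)) - Real.log (ρ + R - σ t)))
    (g' := fun t => 1 / 2 * ((s' - s) / (σ t - (R - ρ)) - -(s' - s) / (ρ + R - σ t))) hseg ?_ ?_ ?_
  · refine (le_of_eq ?_).trans (h.trans_eq ?_)
    · congr 1; module
    · congr 1; simp only [hσ]; ring_nf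
  · intro t ht
    have := hσm t ht
    exact ((((hσd t).sub_const _).log (by linarith)).sub
      (((hσd t).const_sub _).log (by linarith))).const_mul _
  · have hc : ContinuousOn σ (Icc 0 1) := fun t _ => (hσd t).continuousAt.continuousWithinAt
    refine continuousOn_const.mul ((continuousOn_const.div (hc.sub continuousOn_const) ?_).sub
      (continuousOn_const.div (continuousOn_const.sub hc) ?_))
    · intro t ht
      exact (sub_pos.2 (hs.trans_le (hσm t ht).1)).ne'
    · intro t ht
      exact (by linarith [(hσm t ht).2] : 0 < ρ + R - σ t).ne'
  · intro t ht
    rw [hpt]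
    refine (kobayashiMetric_le_of_ball_subset hρ (hu t ht) hN hsub).trans_eq ?_
    have := hσm t ht
    have e1 : σ t - (R - ρ) ≠ 0 := by linarith
    have e2 : ρ + R - σ t ≠ 0 := by linarith
    have e3 : ρ * (1 - ((R - σ t) / ρ) ^ 2) = (σ t - (R - ρ)) * (ρ + R - σ t) / ρ := by
      field_simp; ring
    rw [e3, abs_sub_comm, abs_of_nonneg (sub_nonneg.2 hss')]
    field_simp
    ring

/-- The radius deficit `R w²` is at most `4 w s` at these depths. Ignoring it costs `8w` in the
first logarithm, and the far side of the ball costs `2w`; halving the sum gives `5w`. -/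
theorem inward_normal_step {p N : E} {R w s s' : ℝ} (hN : ‖N‖ = 1) (hR : 0 < R) (hw : 0 < w)
    (hw8 : w ≤ 1 / 8) (hsub : Metric.ball (p - R • N) (R * (1 - w ^ 2)) ⊆ Ω)
    (hs : R * w / 4 ≤ s) (hss' : s ≤ s') (hs' : s' ≤ R * w) :
    Metric.ball (p - s • N) (s / 2) ⊆ Ω ∧
      kobayashiEDist Ω (p - s • N) (p - s' • N) ≤
        ENNReal.ofReal (1 / 2 * Real.log (s' / s) + 5 * w) := by
  have hRw : 0 < R * w := mul_pos hR hw
  have hs0 : 0 < s := by linarith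
  have hw2 : R * w ^ 2 ≤ 4 * w * s := by nlinarith
  have hw2s : R * w ^ 2 ≤ s / 2 := by nlinarith
  have hs'R : s' ≤ R := by nlinarith
  have hρ : 0 < R * (1 - w ^ 2) := mul_pos hR (by nlinarith)
  constructor
  · refine Subset.trans (Metric.ball_subset_ball' ?_) hsub
    rw [dist_eq_norm]
    have : p - s • N - (p - R • N) = (R - s) • N := by module
    rw [this, norm_smul, hN, mul_one, Real.norm_of_nonneg (by linarith)]
    linarith
  · refine (kobayashiEDist_diameter_le hN hρ hsub (by linarith) hss' hs'R).trans
      (ENNReal.ofReal_le_ofReal ?_)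
    have h1 : Real.log (s' - (R - R * (1 - w ^ 2))) ≤ Real.log s' :=
      Real.log_le_log (by linarith) (by nlinarith [sq_nonneg w])
    have h2 : Real.log s - 8 * w ≤ Real.log (s - (R - R * (1 - w ^ 2))) := by
      have h := neg_log_one_sub_le (x := R * w ^ 2 / s) (by positivity)
        (by rw [div_le_iff₀ hs0]; linarith)
      have h' : s - (R - R * (1 - w ^ 2)) = s * (1 - R * w ^ 2 / s) := by field_simp; ring
      have hx : R * w ^ 2 / s ≤ 4 * w := by rw [div_le_iff₀ hs0]; linarith
      have hx' : R * w ^ 2 / s ≤ 1 / 2 := by rw [div_le_iff₀ hs0]; linarith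
      rw [h', Real.log_mul hs0.ne' (by linarith)]
      linarith
    have h3 : Real.log (R * (1 - w ^ 2) + R - s) ≤ Real.log (2 * R) :=
      Real.log_le_log (by nlinarith) (by nlinarith [sq_nonneg w])
    have h4 : Real.log (2 * R) - 2 * w ≤ Real.log (R * (1 - w ^ 2) + R - s') := by
      have h := neg_log_one_sub_le (x := w) hw.le (by linarith)
      have h' : Real.log (2 * R * (1 - w)) ≤ Real.log (R * (1 - w ^ 2) + R - s') :=
        Real.log_le_log (mul_pos (by linarith) (by linarith)) (by nlinarith)
      rw [Real.log_mul (by linarith) (by linarith)] at h'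
      linarith
    rw [Real.log_div (by linarith) hs0.ne']
    linarith

/-- Near a Dini-smooth boundary point, the cost of moving along the inner normal is
`½ log (s' / s)` up to an additive constant. -/
theorem inward_normal_chain (hC : Convex ℝ Ω) {p N : E} (hN : ‖N‖ = 1) {R w : ℕ → ℝ}
    (hR : ∀ k, 0 < R k) (hRs : ∀ k, R (k + 1) = R k / 2) (hw : ∀ k, 0 < w k)
    (hw8 : ∀ k, w k ≤ 1 / 8) (hwsum : Summable w) (hwl : ∀ k, w k / 2 ≤ w (k + 1))
    (hwu : ∀ k, w (k + 1) ≤ 3 / 2 * w k)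
    (hsub : ∀ k, Metric.ball (p - R k • N) (R k * (1 - w k ^ 2)) ⊆ Ω) (s s' : ℝ) (hs : 0 < s)
    (hss' : s ≤ s') (hs' : s' ≤ R 0 * w 0) :
    Metric.ball (p - s' • N) (s' / 2) ⊆ Ω ∧
      kobayashiEDist Ω (p - s • N) (p - s' • N) ≤
        ENNReal.ofReal (1 / 2 * Real.log (s' / s) + 5 * ∑' k, w k) := by
  have hstep : ∀ k, R k * w k / 4 ≤ R (k + 1) * w (k + 1) := fun k => by
    rw [hRs]; nlinarith [hR k, hwl k]
  have hmono : ∀ k, R (k + 1) * w (k + 1) ≤ R k * w k := fun k => by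
    rw [hRs]; nlinarith [hR k, hwu k, mul_pos (hR k) (hw k)]
  -- Induction over scales: the path is cut at the depths `R k * w k`, the logarithms telescope, and
  -- scale `k` contributes an error `5 * w k`.
  have key : ∀ n : ℕ, ∀ s s', R n * w n ≤ s → s ≤ s' → s' ≤ R 0 * w 0 →
      Metric.ball (p - s • N) (s / 2) ⊆ Ω ∧ kobayashiEDist Ω (p - s • N) (p - s' • N) ≤
        ENNReal.ofReal (1 / 2 * Real.log (s' / s) + 5 * ∑ k ∈ Finset.range n, w k) := by
    intro n
    induction n with
    | zero =>
      intro s s' h1 h2 h3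
      obtain rfl : s = s' := le_antisymm h2 (h3.trans h1)
      obtain rfl : s = R 0 * w 0 := le_antisymm h3 h1
      have hpos := mul_pos (hR 0) (hw 0)
      have hb := (inward_normal_step hN (hR 0) (hw 0) (hw8 0) (hsub 0) (by linarith) le_rfl h3).1
      exact ⟨hb, by rw [kobayashiEDist_self hC (half_pos hpos) hb]; exact bot_le⟩
    | succ n ih =>
      intro s s' h1 h2 h3
      have hpos : 0 < R n * w n := mul_pos (hR n) (hw n)
      have hspos : 0 < s := (mul_pos (hR _) (hw _)).trans_le h1
      have hwn := hw n
      have hsum0 : 0 ≤ ∑ k ∈ Finset.range n, w k := Finset.sum_nonneg fun k _ => (hw k).le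
      rw [Finset.sum_range_succ]
      rcases le_total (R n * w n) s with h | h
      · obtain ⟨a, b⟩ := ih s s' h h2 h3
        exact ⟨a, b.trans (ENNReal.ofReal_le_ofReal (by linarith))⟩
      · have hlow := (hstep n).trans h1
        rcases le_total s' (R n * w n) with h' | h'
        · obtain ⟨a, b⟩ := inward_normal_step hN (hR n) (hw n) (hw8 n) (hsub n) hlow h2 h'
          exact ⟨a, b.trans (ENNReal.ofReal_le_ofReal (by linarith))⟩
        · obtain ⟨a, b⟩ := inward_normal_step hN (hR n) (hw n) (hw8 n) (hsub n) hlow h le_rfl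
          obtain ⟨-, d⟩ := ih (R n * w n) s' le_rfl h' h3
          refine ⟨a, (kobayashiEDist_triangle Ω _ _ _).trans ((add_le_add b d).trans ?_)⟩
          have l1 : 0 ≤ Real.log (R n * w n / s) := Real.log_nonneg ((one_le_div hspos).2 h)
          have l2 : 0 ≤ Real.log (s' / (R n * w n)) := Real.log_nonneg ((one_le_div hpos).2 h')
          rw [← ENNReal.ofReal_add (by linarith) (by linarith)]
          refine ENNReal.ofReal_le_ofReal ?_
          rw [Real.log_div hpos.ne' hspos.ne', Real.log_div (hspos.trans_le h2).ne' hpos.ne',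
            Real.log_div (hspos.trans_le h2).ne' hspos.ne']
          linarith
  have hex : ∀ s : ℝ, 0 < s → ∃ n, R n * w n ≤ s := fun s hs => by
    have hRn : ∀ n, R n = R 0 * (1 / 2) ^ n := fun n => by
      induction n with
      | zero => simp
      | succ n ih => rw [hRs, ih, pow_succ]; ring
    obtain ⟨n, hn⟩ := exists_pow_lt_of_lt_one (div_pos hs (hR 0)) (by norm_num : (1 / 2 : ℝ) < 1)
    rw [lt_div_iff₀ (hR 0)] at hn
    refine ⟨n, ?_⟩
    have h1 := hRn n
    have h2 := hR n
    nlinarith [hw8 n, hw n]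
  obtain ⟨n, hn⟩ := hex s hs
  obtain ⟨m, hm⟩ := hex s' (hs.trans_le hss')
  refine ⟨(key m s' s' hm le_rfl hs').1,
    (key n s s' hn hss' hs').2.trans (ENNReal.ofReal_le_ofReal ?_)⟩
  have := hwsum.sum_le_tsum (Finset.range n) fun k _ => (hw k).le
  linarith

/-! ### Uniform normal estimate and the upper bound for the distance. -/

/-- The conclusion of the normal estimate at the boundary point `p`, with constants `C` and `s₀`. -/
def NormalEstimate (Ω : Set E) (C s₀ : ℝ) (p : E) : Prop :=
  ∃ N : E, ‖N‖ = 1 ∧ (∀ x ∈ Ω, (inner ℂ N (x - p)).re ≤ 0) ∧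
    ∀ s s' : ℝ, 0 < s → s ≤ s' → s' ≤ s₀ → Metric.ball (p - s' • N) (s' / 2) ⊆ Ω ∧
      kobayashiEDist Ω (p - s • N) (p - s' • N) ≤ ENNReal.ofReal (1 / 2 * Real.log (s' / s) + C)

theorem NormalEstimate.mono {C C' s₀ s₀' : ℝ} {p : E} (h : NormalEstimate Ω C s₀ p) (hC : C ≤ C')
    (hs : s₀' ≤ s₀) : NormalEstimate Ω C' s₀' p := by
  obtain ⟨N, hN, hsupp, hest⟩ := h
  refine ⟨N, hN, hsupp, fun s s' h1 h2 h3 => ⟨(hest s s' h1 h2 (h3.trans hs)).1,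
    (hest s s' h1 h2 (h3.trans hs)).2.trans (ENNReal.ofReal_le_ofReal (by linarith))⟩⟩

theorem exists_normalEstimate_nhds (hO : IsOpen Ω) (hC : Convex ℝ Ω) {p₀ : E}
    (hp₀ : IsDiniSmoothAt Ω p₀) :
    ∃ V ∈ nhds p₀, ∃ C s₀ : ℝ, 0 < C ∧ 0 < s₀ ∧ ∀ p ∈ frontier Ω ∩ V, NormalEstimate Ω C s₀ p := by
  obtain ⟨U, r, ν, hU, hpU, hr, hν, hint⟩ := hp₀
  obtain ⟨η, hη, hηU⟩ := Metric.isOpen_iff.1 hU p₀ hpU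
  have hunit : ∀ q ∈ frontier Ω ∩ U, ‖ν q‖ = 1 := fun q hq => (hν q hq).1
  set M := modulusOfContinuity ν (frontier Ω ∩ U) with hM
  have hMmono : MonotoneOn M (Ioi 0) := modulusOfContinuity_monotoneOn hunit
  have hMsum : Summable fun k : ℕ => M ((1 / 2) ^ k) :=
    summable_dyadic_of_integrableOn_div (modulusOfContinuity_nonneg _ _) hMmono hint
  have hgeom : Summable fun k : ℕ => (1 / 2 : ℝ) ^ k := summable_geometric_two
  -- The summand `(1/2)^k` makes the sequence strictly positive even where the modulus vanishes.
  obtain ⟨w, hMw, hwsum, hwl, hwu⟩ := exists_summable_regular_majorant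
    (ω := fun k : ℕ => M ((1 / 2) ^ k) + (1 / 2) ^ k)
    (fun k => add_pos_of_nonneg_of_pos (modulusOfContinuity_nonneg _ _ _) (by positivity))
    (fun i j hij => add_le_add
      (hMmono (mem_Ioi.2 (by positivity)) (mem_Ioi.2 (by positivity))
        (pow_le_pow_of_le_one (by norm_num) (by norm_num) hij))
      (pow_le_pow_of_le_one (by norm_num) (by norm_num) hij)) (hMsum.add hgeom)
  have hwM : ∀ k, M ((1 / 2) ^ k) ≤ w k := fun k => by
    have := hMw k
    have h2 : (0 : ℝ) < (1 / 2) ^ k := by positivity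
    linarith
  have hwpos : ∀ k, 0 < w k := fun k => by
    have := hMw k
    have h2 : (0 : ℝ) < (1 / 2) ^ k := by positivity
    have h3 := modulusOfContinuity_nonneg ν (frontier Ω ∩ U) ((1 / 2) ^ k)
    linarith
  -- From `k₀` on, the oscillation is at most `1/8` and the balls of radius `2^{-k}` about points
  -- near `p₀` stay in `U`; `k₀` does not depend on `p`.
  obtain ⟨k₀, hk₀⟩ := (((hwsum.tendsto_atTop_zero.eventually_le_const
    (by norm_num : (0 : ℝ) < 1 / 8)).and
    (hgeom.tendsto_atTop_zero.eventually_le_const (half_pos hη)))).exists_forall_of_atTop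
  refine ⟨Metric.ball p₀ (η / 2), Metric.ball_mem_nhds _ (half_pos hη), 5 * ∑' k, w (k + k₀),
    1 / 2 * (1 / 2) ^ k₀ * w k₀, ?_, mul_pos (by positivity) (hwpos _), fun p hp => ?_⟩
  · have := ((summable_nat_add_iff k₀).2 hwsum).tsum_pos (fun k => (hwpos _).le) 0 (hwpos _)
    linarith
  have hball : ∀ k, k₀ ≤ k → Metric.ball p ((1 / 2) ^ k) ⊆ U := fun k hk =>
    Subset.trans (Metric.ball_subset_ball' (by
      have h1 := (hk₀ k hk).2
      have h2 := Metric.mem_ball.1 hp.2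
      linarith)) hηU
  have hpos : ∀ k : ℕ, (0 : ℝ) < (1 / 2) ^ k := fun k => by positivity
  have hpU : p ∈ frontier Ω ∩ U := ⟨hp.1, hball k₀ le_rfl (Metric.mem_ball_self (hpos _))⟩
  refine ⟨ν p, hunit p hpU, fun x hx => re_inner_normal_nonpos hO hC hU hr hν hpU hx, ?_⟩
  intro s s' h1 h2 h3
  refine inward_normal_chain hC (hunit p hpU) (R := fun k => 1 / 2 * (1 / 2) ^ (k + k₀))
    (w := fun k => w (k + k₀)) (fun k => by positivity) (fun k => by ring)
    (fun k => hwpos _) (fun k => (hk₀ _ (by omega)).1) ((summable_nat_add_iff k₀).2 hwsum)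
    (fun k => by convert hwl (k + k₀) using 2; ring)
    (fun k => by convert hwu (k + k₀) using 2; ring) (fun k => ?_) s s' h1 h2
    (by simpa using h3)
  have hmem : ∀ q ∈ frontier Ω ∩ Metric.ball p ((1 / 2) ^ (k + k₀)), q ∈ frontier Ω ∩ U :=
    fun q hq => ⟨hq.1, hball _ (by omega) hq.2⟩
  refine ball_subset_of_cone (t := (1 / 2) ^ (k + k₀)) (hunit p hpU) (hwpos _).le
    (by linarith [(hk₀ (k + k₀) (by omega)).1]) (by positivity) (by linarith) fun v hv hv2 => ?_
  refine mem_of_re_inner_lt hO hp.1 (fun q hq => hunit q (hmem q hq))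
    (fun q hq x hx => re_inner_normal_nonpos hO hC hU hr hν (hmem q hq) hx)
    (fun q hq => ?_) hv hv2
  refine (norm_sub_le_modulusOfContinuity hunit hpU (hmem q hq) ?_).trans (hwM _)
  rw [← dist_eq_norm, dist_comm]
  exact hq.2

theorem exists_normalEstimate [ProperSpace E] (hO : IsOpen Ω) (hC : Convex ℝ Ω)
    (hB : Bornology.IsBounded Ω) (hD : HasDiniSmoothBoundary Ω) :
    ∃ C s₀ : ℝ, 0 < C ∧ 0 < s₀ ∧ ∀ p ∈ frontier Ω, NormalEstimate Ω C s₀ p := by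
  have hcomp : IsCompact (frontier Ω) :=
    Metric.isCompact_of_isClosed_isBounded isClosed_frontier
      (hB.closure.subset frontier_subset_closure)
  refine hcomp.induction_on
    (p := fun S => ∃ C s₀ : ℝ, 0 < C ∧ 0 < s₀ ∧ ∀ p ∈ S, NormalEstimate Ω C s₀ p) ?_ ?_ ?_ ?_
  · exact ⟨1, 1, one_pos, one_pos, by simp⟩
  · rintro S T hST ⟨C, s₀, h1, h2, h⟩
    exact ⟨C, s₀, h1, h2, fun p hp => h p (hST hp)⟩
  · rintro S T ⟨C, s, h1, h2, h⟩ ⟨C', s', h1', h2', h'⟩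
    refine ⟨max C C', min s s', lt_max_of_lt_left h1, lt_min h2 h2', ?_⟩
    rintro p (hp | hp)
    · exact (h p hp).mono (le_max_left _ _) (min_le_left _ _)
    · exact (h' p hp).mono (le_max_right _ _) (min_le_right _ _)
  · intro p hp
    obtain ⟨V, hV, C, s₀, h1, h2, h⟩ := exists_normalEstimate_nhds hO hC (hD p hp)
    exact ⟨frontier Ω ∩ V, inter_mem_nhdsWithin _ hV, C, s₀, h1, h2, h⟩

/-- Testing the half-space with `x + s N`, `s < δ`, gives `Re⟨N, p - x⟩ ≥ δ = |p - x|`, the equality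
case of Cauchy–Schwarz. -/
theorem sub_eq_neg_smul_of_supporting {x p N : E} {δ : ℝ} (hN : ‖N‖ = 1) (hδ : 0 < δ)
    (hx : ‖x - p‖ = δ) (hball : ∀ y ∈ Metric.ball x δ, (inner ℂ N (y - p)).re ≤ 0) :
    x = p - δ • N := by
  have hNN : inner ℂ N N = 1 := by rw [inner_self_eq_norm_sq_to_K, hN]; simp
  have h1 : ∀ s, 0 ≤ s → s < δ → s ≤ -(inner ℂ N (x - p)).re := fun s h0 hs => by
    have := hball (x + (s : ℂ) • N) (by
      rw [mem_ball_iff_norm, add_sub_cancel_left, norm_smul, hN, Complex.norm_real,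
        Real.norm_of_nonneg h0, mul_one]; exact hs)
    rw [add_sub_right_comm, inner_add_right, inner_smul_right, hNN] at this
    simp at this
    linarith
  have h2 : δ ≤ -(inner ℂ N (x - p)).re := by
    refine le_of_forall_lt fun s hs => ?_
    obtain ⟨t, ht, ht'⟩ := exists_between (max_lt hs hδ)
    exact ((le_max_left _ _).trans_lt ht).trans_le (h1 t ((le_max_right _ _).trans ht.le) ht')
  have h3 : ‖δ • N + (x - p)‖ ^ 2 ≤ 0 := by
    rw [norm_add_sq (𝕜 := ℂ), hx, norm_smul, hN, Real.norm_of_nonneg hδ.le, ← Complex.coe_smul,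
      inner_smul_left]
    simp
    nlinarith
  have h4 : δ • N + (x - p) = 0 := by
    rw [← norm_eq_zero]
    exact pow_eq_zero_iff two_ne_zero |>.1 (le_antisymm h3 (by positivity))
  have : x = (δ • N + (x - p)) + (p - δ • N) := by abel
  rw [this, h4, zero_add]

/-- Every point can be pushed into the domain up to a given scale at logarithmic cost. -/
theorem exists_inward_point [ProperSpace E] (hO : IsOpen Ω) (hC : Convex ℝ Ω)
    (hB : Bornology.IsBounded Ω) (hne : (frontier Ω).Nonempty) (hD : HasDiniSmoothBoundary Ω)
    {B : ℝ} (hBpos : 0 < B) :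
    ∃ C c : ℝ, 0 < C ∧ 0 < c ∧ ∀ x ∈ Ω, ∀ D, 0 < D → D ≤ B → ∃ x', ‖x - x'‖ ≤ D ∧
      Metric.ball x' (c * D) ⊆ Ω ∧
      kobayashiEDist Ω x x' ≤ ENNReal.ofReal (1 / 2 * Real.log (1 + D / bdryDist Ω x) + C) := by
  obtain ⟨C, s₀, hCpos, hs₀, hest⟩ := exists_normalEstimate hO hC hB hD
  have hc : 0 < min 1 (s₀ / B) / 2 := half_pos (lt_min one_pos (div_pos hs₀ hBpos))
  refine ⟨C, min 1 (s₀ / B) / 2, hCpos, hc, fun x hx D hDpos hDB => ?_⟩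
  -- The normal estimate is available only up to depth `s₀`; `D ≤ B` keeps `s'` comparable to `D`.
  set s' := min D s₀ with hs'
  have hs'pos : 0 < s' := lt_min hDpos hs₀
  have hcD : min 1 (s₀ / B) / 2 * D ≤ s' / 2 := by
    have h1 : min 1 (s₀ / B) * D ≤ s' := by
      refine le_min ?_ ?_
      · nlinarith [min_le_left 1 (s₀ / B)]
      · calc min 1 (s₀ / B) * D ≤ s₀ / B * B :=
              mul_le_mul (min_le_right _ _) hDB hDpos.le (by positivity)
          _ = s₀ := div_mul_cancel₀ _ hBpos.ne'
    linarith
  have hδ := bdryDist_pos hO hne hx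
  have hb := ball_bdryDist_subset hO hx
  rcases le_or_gt s' (bdryDist Ω x) with h | h
  · refine ⟨x, by simpa using hDpos.le, (Metric.ball_subset_ball (by linarith)).trans hb, ?_⟩
    rw [kobayashiEDist_self hC hδ hb]; exact bot_le
  · obtain ⟨p, hp, hdist⟩ := isClosed_frontier.exists_infDist_eq_dist hne x
    obtain ⟨N, hN, hsupp, hN'⟩ := hest p hp
    have hxp : x = p - bdryDist Ω x • N := sub_eq_neg_smul_of_supporting hN hδ
      (by rw [bdryDist, hdist, dist_eq_norm]) fun y hy => hsupp y (hb hy)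
    obtain ⟨h1, h2⟩ := hN' _ s' hδ h.le (min_le_right _ _)
    rw [← hxp] at h2
    refine ⟨p - s' • N, ?_, (Metric.ball_subset_ball hcD).trans h1,
      h2.trans (ENNReal.ofReal_le_ofReal ?_)⟩
    · have : x - (p - s' • N) = (s' - bdryDist Ω x) • N := by
        nth_rw 1 [hxp]; module
      rw [this, norm_smul, hN, mul_one, Real.norm_of_nonneg (by linarith)]
      linarith [min_le_left D s₀]
    · have hle : s' / bdryDist Ω x ≤ 1 + D / bdryDist Ω x := by
        have := div_le_div_of_nonneg_right (min_le_left D s₀) hδ.le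
        linarith
      have := Real.log_le_log (by positivity) hle
      linarith

/-- The upper estimate of the Kobayashi distance on convex domains with Dini-smooth boundary. -/
theorem exists_kobayashiDist_le [ProperSpace E] (hO : IsOpen Ω) (hC : Convex ℝ Ω)
    (hB : Bornology.IsBounded Ω) (hne : (frontier Ω).Nonempty) (hD : HasDiniSmoothBoundary Ω) :
    ∃ C : ℝ, 0 < C ∧ ∀ x ∈ Ω, ∀ y ∈ Ω, x ≠ y →
      kobayashiDist Ω x y ≤ 1 / 2 * Real.log (1 + ‖x - y‖ / bdryDist Ω x) +
        1 / 2 * Real.log (1 + ‖x - y‖ / bdryDist Ω y) + C := by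
  obtain ⟨B, hBd⟩ := hB.exists_norm_le
  have hB1 : ∀ x ∈ Ω, ∀ y ∈ Ω, ‖x - y‖ ≤ 2 * |B| + 1 := fun x hx y hy => by
    have := norm_sub_le x y
    linarith [hBd x hx, hBd y hy, le_abs_self B]
  obtain ⟨C, c, hCpos, hc, h⟩ := exists_inward_point hO hC hB hne hD
    (B := 2 * |B| + 1) (by positivity)
  -- Both points are pushed inwards at scale `D = ‖x - y‖`. The new points are at most `3D` apart
  -- and carry balls of radius `c D`, so joining them costs at most `3 / c`.
  refine ⟨C + 3 / c + C, by positivity, fun x hx y hy hxy => ?_⟩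
  have hDpos : 0 < ‖x - y‖ := norm_pos_iff.2 (sub_ne_zero.2 hxy)
  obtain ⟨x', hx1, hx2, hx3⟩ := h x hx _ hDpos (hB1 x hx y hy)
  obtain ⟨y', hy1, hy2, hy3⟩ := h y hy _ hDpos (hB1 x hx y hy)
  have hlx : 0 ≤ Real.log (1 + ‖x - y‖ / bdryDist Ω x) :=
    Real.log_nonneg (by have := div_pos hDpos (bdryDist_pos hO hne hx); linarith)
  have hly : 0 ≤ Real.log (1 + ‖x - y‖ / bdryDist Ω y) :=
    Real.log_nonneg (by have := div_pos hDpos (bdryDist_pos hO hne hy); linarith)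
  have hmid : kobayashiEDist Ω x' y' ≤ ENNReal.ofReal (3 / c) := by
    refine (kobayashiEDist_le_norm_div hC (mul_pos hc hDpos) hx2 hy2).trans
      (ENNReal.ofReal_le_ofReal ?_)
    have h3 : ‖y' - x'‖ ≤ 3 * ‖x - y‖ := by
      have : y' - x' = -(y - y') + -(x - y) + (x - x') := by abel
      rw [this]
      refine (norm_add₃_le).trans ?_
      rw [norm_neg, norm_neg]
      linarith
    rw [div_le_div_iff₀ (mul_pos hc hDpos) hc]
    nlinarith
  refine kobayashiDist_le_of_edist_le (by positivity) ?_
  refine (kobayashiEDist_triangle Ω x x' y).trans ?_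
  refine (add_le_add hx3 ((kobayashiEDist_triangle Ω x' y' y).trans
    (add_le_add hmid ((kobayashiEDist_comm Ω y' y).trans_le hy3)))).trans_eq ?_
  rw [← ENNReal.ofReal_add (by positivity) (by positivity),
    ← ENNReal.ofReal_add (by positivity) (by positivity)]
  congr 1
  ring

/-! ### Stability of quasi-geodesics. -/

theorem continuousOn_of_abs_sub_le {f : ℝ → ℝ} {S : Set ℝ} {K : ℝ} (hK : 0 ≤ K)
    (h : ∀ s ∈ S, ∀ t ∈ S, |f s - f t| ≤ K * |s - t|) : ContinuousOn f S := by
  refine LipschitzOnWith.continuousOn (K := K.toNNReal)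
    (LipschitzOnWith.of_dist_le_mul fun s hs t ht => ?_)
  rw [Real.coe_toNNReal _ hK, Real.dist_eq, Real.dist_eq]
  exact h s hs t ht

/-- Stability of quasi-geodesics in Gromov hyperbolic spaces: `D s t` is the distance of the points
with parameters `s`, `t` of a bi-Lipschitz curve. -/
theorem quasiGeodesic_stability {δ lam : ℝ} (hδ : 0 < δ) (hlam : 1 ≤ lam) :
    ∃ H : ℝ, 0 ≤ H ∧ ∀ (a b : ℝ) (D : ℝ → ℝ → ℝ), a ≤ b →
      (∀ s ∈ Icc a b, D s s = 0) → (∀ s ∈ Icc a b, ∀ t ∈ Icc a b, D s t = D t s) →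
      (∀ s ∈ Icc a b, ∀ t ∈ Icc a b, ∀ u ∈ Icc a b, D s u ≤ D s t + D t u) →
      (∀ s ∈ Icc a b, ∀ t ∈ Icc a b, lam⁻¹ * |s - t| ≤ D s t) →
      (∀ s ∈ Icc a b, ∀ t ∈ Icc a b, D s t ≤ lam * |s - t|) →
      (∀ s ∈ Icc a b, ∀ t ∈ Icc a b, ∀ u ∈ Icc a b, ∀ v ∈ Icc a b,
        D s t + D u v ≤ max (D s u + D t v) (D s v + D t u) + 2 * δ) →
      ∀ t ∈ Icc a b, D a t + D t b ≤ D a b + H := by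
  have hlam0 : 0 < lam := one_pos.trans_le hlam
  -- Chosen so that `δ / τ = 1 / (2 lam)` below: the drift of `u` is then half of the lower
  -- Lipschitz rate.
  obtain ⟨H₀, hH₀⟩ : ∃ H₀, H₀ = 4 * lam ^ 2 * δ := ⟨_, rfl⟩
  have hH₀δ : 4 * δ ≤ H₀ := by rw [hH₀]; nlinarith [one_le_pow₀ hlam (n := 2)]
  have hH₀pos : 0 < H₀ := by linarith
  refine ⟨2 * (H₀ + lam * (2 * lam * (2 * H₀ + 4 * δ))), by positivity, ?_⟩
  intro a b D hab hself hsymm htri hlow hup h4 t ht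
  have ha : a ∈ Icc a b := left_mem_Icc.2 hab
  have hb : b ∈ Icc a b := right_mem_Icc.2 hab
  -- `h` is the Gromov product of `a` and `b` seen from the curve (its height over the chord), `u`
  -- the position along the chord.
  set h : ℝ → ℝ := fun s => (D a s + D s b - D a b) / 2 with hh
  set u : ℝ → ℝ := fun s => (D a s - D s b) / 2 with hu
  set τ := H₀ / (2 * lam) with hτ
  have hτpos : 0 < τ := by positivity
  have hh0 : ∀ s ∈ Icc a b, 0 ≤ h s := fun s hs => by
    have := htri a ha s hs b hb; simp only [hh]; linarith
  have hhlip : ∀ s ∈ Icc a b, ∀ t ∈ Icc a b, h t ≤ h s + lam * |s - t| := fun s hs t ht => by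
    have h1 := htri a ha s hs t ht
    have h2 := htri t ht s hs b hb
    have h3 := hup s hs t ht
    rw [hsymm t ht s hs] at h2
    simp only [hh]; linarith
  -- Four-point inequality for `a, s, t, b`: one alternative is the claim, and in the other the
  -- large heights already force `u s - u t ≤ 0`.
  have hcontr' : ∀ s ∈ Icc a b, ∀ t ∈ Icc a b, |s - t| ≤ τ → H₀ < h s + h t → u s - u t ≤ δ := by
    intro s hs t ht hst hH
    have h1 := h4 a ha s hs t ht b hb
    have h2 := hup s hs t ht
    have h3 : lam * |s - t| ≤ H₀ / 2 := by
      calc lam * |s - t| ≤ lam * τ := by gcongr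
        _ = H₀ / 2 := by rw [hτ]; field_simp
    rcases max_cases (D a t + D s b) (D a b + D s t) with ⟨h5, -⟩ | ⟨h5, -⟩ <;> rw [h5] at h1 <;>
      simp only [hh, hu] at * <;> linarith
  have hcontr : ∀ s ∈ Icc a b, ∀ t ∈ Icc a b, |s - t| ≤ τ → (H₀ < h s ∨ H₀ < h t) →
      |u s - u t| ≤ δ := by
    intro s hs t ht hst hH
    have hsum : H₀ < h s + h t := by
      rcases hH with hH | hH
      · linarith [hh0 t ht]
      · linarith [hh0 s hs]
    rw [abs_sub_le_iff]
    exact ⟨hcontr' s hs t ht hst hsum,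
      hcontr' t ht s hs (abs_sub_comm s t ▸ hst) (by linarith)⟩
  have hchain : ∀ n : ℕ, ∀ p ∈ Icc a b, ∀ q ∈ Icc a b, p ≤ q → q - p ≤ n * τ →
      (∀ s ∈ Ioo p q, H₀ < h s) → (H₀ < h p ∨ H₀ < h q) → |u p - u q| ≤ n * δ := by
    intro n
    induction n with
    | zero =>
      intro p hp q hq hpq hle _ _
      have : p = q := by
        simp only [Nat.cast_zero, zero_mul] at hle
        linarith
      simp [this]
    | succ n ih =>
      intro p hp q hq hpq hle hin hend
      push_cast at hle ⊢
      rcases le_or_gt (q - p) τ with h1 | h1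
      · have := hcontr p hp q hq (by rw [abs_sub_comm, abs_of_nonneg (by linarith)]; exact h1) hend
        nlinarith [n.cast_nonneg (α := ℝ)]
      · have hq' : q - τ ∈ Ioo p q := ⟨by linarith, by linarith⟩
        have hq'm : q - τ ∈ Icc a b := ⟨hp.1.trans hq'.1.le, hq'.2.le.trans hq.2⟩
        have h2 := ih p hp (q - τ) hq'm hq'.1.le (by linarith)
          (fun s hs => hin s ⟨hs.1, hs.2.trans hq'.2⟩) (Or.inr (hin _ hq'))
        have h3 := hcontr (q - τ) hq'm q hq
          (by rw [sub_sub_cancel_left, abs_neg, abs_of_pos hτpos]) (Or.inl (hin _ hq'))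
        calc |u p - u q| = |(u p - u (q - τ)) + (u (q - τ) - u q)| := by congr 1; ring
          _ ≤ _ := abs_add_le _ _
          _ ≤ _ := by linarith
  have hchain' : ∀ p ∈ Icc a b, ∀ q ∈ Icc a b, p ≤ q → (∀ s ∈ Ioo p q, H₀ < h s) →
      (H₀ < h p ∨ H₀ < h q) → |u p - u q| ≤ ((q - p) / τ + 1) * δ := by
    intro p hp q hq hpq hin hend
    have h0 : 0 ≤ (q - p) / τ := div_nonneg (by linarith) hτpos.le
    refine (hchain ⌈(q - p) / τ⌉₊ p hp q hq hpq ?_ hin hend).trans ?_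
    · rw [← div_le_iff₀ hτpos]; exact Nat.le_ceil _
    · gcongr; exact (Nat.ceil_lt_add_one h0).le
  have hbound : h t ≤ H₀ + lam * (2 * lam * (2 * H₀ + 4 * δ)) := by
    rcases le_or_gt (h t) H₀ with hle | hgt
    · have : 0 ≤ lam * (2 * lam * (2 * H₀ + 4 * δ)) := by positivity
      linarith
    have hcont : ContinuousOn h (Icc a b) := by
      refine continuousOn_of_abs_sub_le hlam0.le fun s hs t ht => ?_
      have h1 := hhlip s hs t ht
      have h2 := hhlip t ht s hs
      rw [abs_sub_comm t s] at h2
      exact abs_sub_le_iff.2 ⟨by linarith, by linarith⟩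
    have hha : h a = 0 := by simp only [hh, hself a ha]; ring
    have hhb : h b = 0 := by simp only [hh, hself b hb]; ring
    have hat : Icc a t ⊆ Icc a b := Icc_subset_Icc_right ht.2
    have htb : Icc t b ⊆ Icc a b := Icc_subset_Icc_left ht.1
    -- `(s₁, s₂)` is the excursion above height `H₀` around `t`. On it `u` drifts by at most `(s₂ -
    -- s₁) / (2 lam) + 2 δ`, while the curve advances by at least `(s₂ - s₁) / lam`; so the
    -- excursion is short, and `h t` is bounded.
    obtain ⟨s₁, ⟨hs₁, hs₁H⟩, hmax⟩ := (isCompact_Icc.of_isClosed_subset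
      ((hcont.mono hat).preimage_isClosed_of_isClosed isClosed_Icc (isClosed_Iic (a := H₀)))
      inter_subset_left).exists_isGreatest ⟨a, left_mem_Icc.2 ht.1, by simp [hha, hH₀pos.le]⟩
    obtain ⟨s₂, ⟨hs₂, hs₂H⟩, hmin⟩ := (isCompact_Icc.of_isClosed_subset
      ((hcont.mono htb).preimage_isClosed_of_isClosed isClosed_Icc (isClosed_Iic (a := H₀)))
      inter_subset_left).exists_isLeast ⟨b, right_mem_Icc.2 ht.2, by simp [hhb, hH₀pos.le]⟩
    have hin₁ : ∀ s ∈ Ioo s₁ t, H₀ < h s := fun s hs => by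
      by_contra hc
      exact not_lt.2 (hmax ⟨⟨hs₁.1.trans hs.1.le, hs.2.le⟩, not_lt.1 hc⟩) hs.1
    have hin₂ : ∀ s ∈ Ioo t s₂, H₀ < h s := fun s hs => by
      by_contra hc
      exact not_lt.2 (hmin ⟨⟨hs.1.le, hs.2.le.trans hs₂.2⟩, not_lt.1 hc⟩) hs.2
    have hs₁m := hat hs₁
    have hs₂m := htb hs₂
    have e1 := hchain' s₁ hs₁m t ht hs₁.2 hin₁ (Or.inr hgt)
    have e2 := hchain' t ht s₂ hs₂m hs₂.1 hin₂ (Or.inl hgt)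
    have e3 : D s₁ s₂ ≤ h s₁ + h s₂ + |u s₁ - u s₂| + 2 * δ := by
      have h1 := h4 s₁ hs₁m s₂ hs₂m a ha b hb
      rw [hsymm s₁ hs₁m a ha, hsymm s₂ hs₂m a ha] at h1
      rcases max_cases (D a s₁ + D s₂ b) (D s₁ b + D a s₂) with ⟨h5, -⟩ | ⟨h5, -⟩ <;>
        rw [h5] at h1
      · have := le_abs_self (u s₁ - u s₂)
        simp only [hh, hu] at *; linarith
      · have := neg_le_abs (u s₁ - u s₂)
        simp only [hh, hu] at *; linarith
    have e4 : |u s₁ - u s₂| ≤ ((s₂ - s₁) / τ + 2) * δ := by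
      calc |u s₁ - u s₂| = |(u s₁ - u t) + (u t - u s₂)| := by congr 1; ring
        _ ≤ _ := abs_add_le _ _
        _ ≤ ((t - s₁) / τ + 1) * δ + ((s₂ - t) / τ + 1) * δ := add_le_add e1 e2
        _ = _ := by ring
    have e5 : (s₂ - s₁) / τ * δ = (s₂ - s₁) / (2 * lam) := by
      rw [hτ, hH₀]; field_simp; ring
    have e6 := hlow s₁ hs₁m s₂ hs₂m
    have hle : s₁ ≤ s₂ := hs₁.2.trans hs₂.1
    rw [abs_sub_comm, abs_of_nonneg (by linarith)] at e6
    have e7 : lam⁻¹ * (s₂ - s₁) = 2 * ((s₂ - s₁) / (2 * lam)) := by field_simp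
    have e8 : (s₂ - s₁) / (2 * lam) ≤ 2 * H₀ + 4 * δ := by
      have h1 : h s₁ ≤ H₀ := hs₁H
      have h2 : h s₂ ≤ H₀ := hs₂H
      linarith
    rw [div_le_iff₀ (by positivity)] at e8
    have e9 := hhlip s₁ hs₁m t ht
    rw [abs_sub_comm, abs_of_nonneg (by linarith [hs₁.2])] at e9
    have h1 : h s₁ ≤ H₀ := hs₁H
    have e10 : lam * (t - s₁) ≤ lam * (2 * lam * (2 * H₀ + 4 * δ)) := by
      gcongr
      linarith [hs₂.1]
    linarith
  simp only [hh] at hbound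
  linarith

/-! ### Euclidean length of curves that are bi-Lipschitz for the Kobayashi distance. -/

/-- Chaining steps of length at most `1` makes the bound global; then `G` is monotone and its
variation dominates that of `γ`. -/
theorem eVariationOn_le_of_norm_sub_le {F : Type*} [NormedAddCommGroup F] {γ : ℝ → F} {G : ℝ → ℝ}
    {a b : ℝ} (hab : a ≤ b)
    (h : ∀ s ∈ Icc a b, ∀ t ∈ Icc a b, s ≤ t → t - s ≤ 1 → ‖γ t - γ s‖ ≤ G t - G s) :
    eVariationOn γ (Icc a b) ≤ ENNReal.ofReal (G b - G a) := by
  have hglob : ∀ n : ℕ, ∀ s ∈ Icc a b, ∀ t ∈ Icc a b, s ≤ t → t - s ≤ n + 1 →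
      ‖γ t - γ s‖ ≤ G t - G s := by
    intro n
    induction n with
    | zero => intro s hs t ht hst hle; exact h s hs t ht hst (by simpa using hle)
    | succ n ih =>
      intro s hs t ht hst hle
      push_cast at hle
      rcases le_or_gt (t - s) 1 with h1 | h1
      · exact h s hs t ht hst h1
      · have hm : t - 1 ∈ Icc a b := ⟨by linarith [hs.1], by linarith [ht.2]⟩
        have h2 := ih s hs (t - 1) hm (by linarith) (by linarith)
        have h3 := h (t - 1) hm t ht (by linarith) (by linarith)
        linarith [norm_sub_le_norm_sub_add_norm_sub (γ t) (γ (t - 1)) (γ s)]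
  have hall : ∀ s ∈ Icc a b, ∀ t ∈ Icc a b, s ≤ t → ‖γ t - γ s‖ ≤ G t - G s :=
    fun s hs t ht hst => hglob ⌈t - s⌉₊ s hs t ht hst (by linarith [Nat.le_ceil (t - s)])
  have hmono : MonotoneOn G (Icc a b) := fun s hs t ht hst => by
    linarith [hall s hs t ht hst, norm_nonneg (γ t - γ s)]
  have hG := hmono.eVariationOn_eq (left_mem_Icc.2 hab) (right_mem_Icc.2 hab)
  rw [inter_self] at hG
  rw [← hG]
  refine iSup_le fun p => le_trans (Finset.sum_le_sum fun i _ => ?_)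
    (eVariationOn.sum_le (f := G) (n := p.1) p.2.2.1 fun i => p.2.2.2 i)
  rw [edist_dist, edist_dist, dist_eq_norm, Real.dist_eq]
  exact ENNReal.ofReal_le_ofReal
    ((hall _ (p.2.2.2 i) _ (p.2.2.2 (i + 1)) (p.2.2.1 (Nat.le_succ i))).trans (le_abs_self _))

theorem eVariationOn_le_of_exp_decay {F : Type*} [NormedAddCommGroup F] {γ : ℝ → F}
    {a b c K t₀ : ℝ} (hc : 0 < c) (hK : 0 ≤ K) (ht₀ : t₀ ∈ Icc a b)
    (h : ∀ s ∈ Icc a b, ∀ t ∈ Icc a b, |s - t| ≤ 1 →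
      ‖γ t - γ s‖ ≤ K * Real.exp (-(c * |s - t₀|)) * |s - t|) :
    eVariationOn γ (Icc a b) ≤ ENNReal.ofReal (2 * K / c) := by
  have hexp : ∀ A d : ℝ, K * Real.exp A * d ≤ K / c * Real.exp (A + c * d) - K / c * Real.exp A := by
    intro A d
    have h1 := Real.add_one_le_exp (c * d)
    have h2 : K / c * Real.exp (A + c * d) - K / c * Real.exp A =
        K / c * Real.exp A * (Real.exp (c * d) - 1) := by rw [Real.exp_add]; ring
    rw [h2]
    calc K * Real.exp A * d = K / c * Real.exp A * (c * d) := by field_simp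
      _ ≤ _ := by gcongr; linarith
  have h1 : eVariationOn γ (Icc a t₀) ≤ ENNReal.ofReal (K / c) := by
    refine (eVariationOn_le_of_norm_sub_le (G := fun t => K / c * Real.exp (c * (t - t₀))) ht₀.1
      fun s hs t ht hst hle => ?_).trans (ENNReal.ofReal_le_ofReal ?_)
    · have := h s ⟨hs.1, hs.2.trans ht₀.2⟩ t ⟨ht.1, ht.2.trans ht₀.2⟩
        (by rw [abs_sub_comm, abs_of_nonneg (by linarith)]; exact hle)
      rw [abs_sub_comm s t, abs_of_nonneg (by linarith : 0 ≤ t - s),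
        abs_of_nonpos (by linarith [hs.2] : s - t₀ ≤ 0)] at this
      refine this.trans ((hexp _ _).trans_eq ?_)
      have e1 : -(c * -(s - t₀)) + c * (t - s) = c * (t - t₀) := by ring
      have e2 : -(c * -(s - t₀)) = c * (s - t₀) := by ring
      rw [e1, e2]
    · have : 0 ≤ K / c * Real.exp (c * (a - t₀)) := by positivity
      simp only [sub_self, mul_zero, Real.exp_zero, mul_one]
      linarith
  have h2 : eVariationOn γ (Icc t₀ b) ≤ ENNReal.ofReal (K / c) := by
    refine (eVariationOn_le_of_norm_sub_le (G := fun t => -(K / c * Real.exp (-(c * (t - t₀))))) ht₀.2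
      fun s hs t ht hst hle => ?_).trans (ENNReal.ofReal_le_ofReal ?_)
    -- The arguments are swapped so that the weight sits at `t`, the endpoint farther from `t₀`.
    · have := h t ⟨ht₀.1.trans ht.1, ht.2⟩ s ⟨ht₀.1.trans hs.1, hs.2⟩
        (by rw [abs_of_nonneg (by linarith)]; exact hle)
      rw [abs_of_nonneg (by linarith : 0 ≤ t - s), norm_sub_rev,
        abs_of_nonneg (by linarith [ht.1] : 0 ≤ t - t₀)] at this
      refine this.trans ((hexp _ _).trans_eq ?_)
      have e1 : -(c * (t - t₀)) + c * (t - s) = -(c * (s - t₀)) := by ring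
      rw [e1]; ring
    · have : 0 ≤ K / c * Real.exp (-(c * (b - t₀))) := by positivity
      simp only [sub_self, mul_zero, neg_zero, Real.exp_zero, mul_one]
      linarith
  have hsplit := eVariationOn.Icc_add_Icc γ ht₀.1 ht₀.2 ht₀
  rw [inter_eq_right.2 (Icc_subset_Icc_right ht₀.2), inter_eq_right.2 (Icc_subset_Icc_left ht₀.1),
    inter_self] at hsplit
  rw [← hsplit]
  refine (add_le_add h1 h2).trans_eq ?_
  rw [← ENNReal.ofReal_add (by positivity) (by positivity)]
  congr 1; ring

theorem exp_sub_one_le_mul_exp {u M : ℝ} (h0 : 0 ≤ u) (hM : u ≤ M) :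
    Real.exp u - 1 ≤ u * Real.exp M := by
  have h1 := Real.add_one_le_exp (-u)
  have h2 : Real.exp (-u) * Real.exp u = 1 := by rw [← Real.exp_add]; simp
  have h3 := Real.exp_le_exp.2 hM
  nlinarith [Real.exp_pos u]

/-- Euclidean distances are controlled by Kobayashi distances on `m`-convex domains. -/
theorem IsBoundedMConvex.exists_norm_sub_le [ProperSpace E] {m : ℝ} (h : IsBoundedMConvex m Ω)
    (hne : (frontier Ω).Nonempty) :
    ∃ C : ℝ, 0 < C ∧ ∀ z ∈ Ω, ∀ w ∈ Ω, ∀ ρ M : ℝ, bdryDist Ω z ≤ ρ → kobayashiDist Ω z w ≤ M →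
      ‖w - z‖ ≤ C * Real.exp (2 * M) * ρ ^ (1 / m) * kobayashiDist Ω z w := by
  obtain ⟨C, hCpos, hC⟩ := h.exists_bound
  have hm : 0 ≤ 1 / m := (one_div_pos.2 (one_pos.trans h.one_lt)).le
  refine ⟨2 * C, by positivity, fun z hz w hw ρ M hρ hM => ?_⟩
  have hδ := bdryDist_pos h.isOpen hne hz
  have hd := kobayashiDist_nonneg Ω z w
  rcases eq_or_ne (w - z) 0 with h0 | h0
  · rw [h0, norm_zero]
    have : 0 ≤ ρ := hδ.le.trans hρ
    positivity
  · have hexp := exp_sub_one_le_mul_exp (u := 2 * kobayashiDist Ω z w) (M := 2 * M)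
      (by positivity) (by linarith)
    have hexp0 : 0 ≤ Real.exp (2 * kobayashiDist Ω z w) - 1 :=
      sub_nonneg.2 (Real.one_le_exp (by positivity))
    calc ‖w - z‖ ≤ bdryDistDir Ω z (w - z) * (Real.exp (2 * kobayashiDist Ω z w) - 1) :=
          norm_sub_le_bdryDistDir_mul h.isOpen h.convex h.bounded hz hw h0
      _ ≤ (C * ρ ^ (1 / m)) * (2 * kobayashiDist Ω z w * Real.exp (2 * M)) := by
          refine mul_le_mul ((hC z hz _ h0).trans ?_) hexp hexp0 ?_
          · exact mul_le_mul_of_nonneg_left (Real.rpow_le_rpow hδ.le hρ hm) hCpos.le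
          · exact mul_nonneg hCpos.le (Real.rpow_nonneg (hδ.le.trans hρ) _)
      _ = _ := by ring

/-- Length of bi-Lipschitz curves whose endpoints are close with respect to their boundary
distances. -/
theorem exists_length_le_of_lt_bdryDist [ProperSpace E] {m : ℝ} (h : IsBoundedMConvex m Ω)
    (hne : (frontier Ω).Nonempty) {lam : ℝ} (hlam : 1 ≤ lam) :
    ∃ C : ℝ, 0 < C ∧ ∀ (a b : ℝ) (γ : ℝ → E), a ≤ b → MapsTo γ (Icc a b) Ω →
      (∀ s ∈ Icc a b, ∀ t ∈ Icc a b, lam⁻¹ * |s - t| ≤ kobayashiDist Ω (γ s) (γ t)) →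
      (∀ s ∈ Icc a b, ∀ t ∈ Icc a b, kobayashiDist Ω (γ s) (γ t) ≤ lam * |s - t|) →
      0 < ‖γ a - γ b‖ → ‖γ a - γ b‖ ≤ bdryDist Ω (γ a) → ‖γ a - γ b‖ ≤ bdryDist Ω (γ b) →
      eVariationOn γ (Icc a b) ≤ ENNReal.ofReal (C * ‖γ a - γ b‖ ^ (1 / m)) := by
  obtain ⟨C, hCpos, hC⟩ := h.exists_norm_sub_le hne
  have hlam0 : 0 < lam := one_pos.trans_le hlam
  have hm0 : 0 < m := one_pos.trans h.one_lt
  have hm : 0 ≤ 1 / m := (one_div_pos.2 hm0).le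
  have hm1 : 1 / m ≤ 1 := (div_le_one hm0).2 h.one_lt.le
  set A := C * Real.exp (2 * lam ^ 2) * (2 * Real.exp (2 * lam ^ 2)) ^ (1 / m) * lam with hA
  have hApos : 0 < A := by positivity
  refine ⟨A * lam, by positivity, fun a b γ hab hmaps hlow hup hD hDa hDb => ?_⟩
  have ha := left_mem_Icc.2 hab
  have hb := right_mem_Icc.2 hab
  set D := ‖γ a - γ b‖ with hDdef
  set μ := min (bdryDist Ω (γ a)) (bdryDist Ω (γ b)) with hμ
  have hDμ : D ≤ μ := le_min hDa hDb
  have hμpos : 0 < μ := hD.trans_le hDμ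
  -- The straight segment bounds `d_K` by `D / μ ≤ 1`, so the parameter interval is short and `δ`
  -- stays comparable to `μ` from above.
  have hdab : kobayashiDist Ω (γ a) (γ b) ≤ D / μ := by
    rw [hDdef, norm_sub_rev]
    exact kobayashiDist_le_norm_div h.convex hμpos
      ((Metric.ball_subset_ball (min_le_left _ _)).trans (ball_bdryDist_subset h.isOpen (hmaps ha)))
      ((Metric.ball_subset_ball (min_le_right _ _)).trans (ball_bdryDist_subset h.isOpen (hmaps hb)))
  have hlen : b - a ≤ lam * (D / μ) := by
    have := hlow a ha b hb
    rw [abs_sub_comm, abs_of_nonneg (sub_nonneg.2 hab)] at this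
    have h1 := this.trans hdab
    rwa [inv_mul_le_iff₀ hlam0] at h1
  have hDμ1 : D / μ ≤ 1 := (div_le_one hμpos).2 hDμ
  have hlen' : b - a ≤ lam := hlen.trans (by nlinarith)
  have hclose : ∀ s ∈ Icc a b, ∀ t ∈ Icc a b, kobayashiDist Ω (γ s) (γ t) ≤ lam ^ 2 :=
    fun s hs t ht => (hup s hs t ht).trans (by
      have : |s - t| ≤ lam := (abs_sub_le_of_le_of_le hs.1 hs.2 ht.1 ht.2).trans hlen'
      nlinarith)
  have hδa : bdryDist Ω (γ a) ≤ 2 * μ := by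
    rcases min_cases (bdryDist Ω (γ a)) (bdryDist Ω (γ b)) with ⟨h1, -⟩ | ⟨h1, -⟩
    · rw [hμ, h1]; linarith [hD.trans_le hDa]
    · have := bdryDist_le_add Ω (γ a) (γ b)
      rw [hμ, h1]; linarith
  have hδs : ∀ s ∈ Icc a b, bdryDist Ω (γ s) ≤ 2 * Real.exp (2 * lam ^ 2) * μ := fun s hs => by
    have h1 := bdryDist_le_mul_exp h.isOpen h.convex hne (hmaps hs) (hmaps ha)
    have h2 : Real.exp (2 * kobayashiDist Ω (γ s) (γ a)) ≤ Real.exp (2 * lam ^ 2) :=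
      Real.exp_le_exp.2 (by linarith [hclose s hs a ha])
    calc bdryDist Ω (γ s) ≤ _ := h1
      _ ≤ 2 * μ * Real.exp (2 * lam ^ 2) := by gcongr
      _ = _ := by ring
  refine (eVariationOn_le_of_norm_sub_le (G := fun t => A * μ ^ (1 / m) * t) hab
    fun s hs t ht hst _ => ?_).trans (ENNReal.ofReal_le_ofReal ?_)
  · have h1 := hC _ (hmaps hs) _ (hmaps ht) _ _ (hδs s hs) (hclose s hs t ht)
    have h2 := hup s hs t ht
    rw [abs_sub_comm, abs_of_nonneg (sub_nonneg.2 hst)] at h2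
    rw [Real.mul_rpow (by positivity) hμpos.le] at h1
    calc ‖γ t - γ s‖ ≤ _ := h1
      _ ≤ C * Real.exp (2 * lam ^ 2) * ((2 * Real.exp (2 * lam ^ 2)) ^ (1 / m) * μ ^ (1 / m)) *
          (lam * (t - s)) := by gcongr
      _ = _ := by rw [hA]; ring
  · have h1 : μ ^ (1 / m) * (D / μ) ≤ D ^ (1 / m) := by
      calc μ ^ (1 / m) * (D / μ) ≤ μ ^ (1 / m) * (D / μ) ^ (1 / m) := by
            gcongr
            exact Real.self_le_rpow_of_le_one (by positivity) hDμ1 hm1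
        _ = (μ * (D / μ)) ^ (1 / m) := (Real.mul_rpow hμpos.le (by positivity)).symm
        _ = _ := by rw [mul_div_cancel₀ _ hμpos.ne']
    calc A * μ ^ (1 / m) * b - A * μ ^ (1 / m) * a = A * μ ^ (1 / m) * (b - a) := by ring
      _ ≤ A * μ ^ (1 / m) * (lam * (D / μ)) := by gcongr
      _ = A * lam * (μ ^ (1 / m) * (D / μ)) := by ring
      _ ≤ _ := by gcongr

/-- The boundary distance of a point which is almost on a geodesic from `x` to `y` decays
exponentially away from the top of the geodesic. -/
theorem bdryDist_le_exp_neg_abs [ProperSpace E] (hO : IsOpen Ω) (hC : Convex ℝ Ω)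
    (hne : (frontier Ω).Nonempty) {C H : ℝ} (hCpos : 0 ≤ C) (hH : 0 ≤ H) {x y z : E} (hx : x ∈ Ω)
    (hy : y ∈ Ω) (hz : z ∈ Ω) (hxy : 0 < ‖x - y‖)
    (hup : kobayashiDist Ω x y ≤ 1 / 2 * Real.log (1 + ‖x - y‖ / bdryDist Ω x) +
        1 / 2 * Real.log (1 + ‖x - y‖ / bdryDist Ω y) + C)
    (hδx : bdryDist Ω x ≤ 2 * ‖x - y‖) (hδy : bdryDist Ω y ≤ 2 * ‖x - y‖)
    (hgeo : kobayashiDist Ω x z + kobayashiDist Ω z y ≤ kobayashiDist Ω x y + H) :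
    bdryDist Ω z ≤ 9 * Real.exp (2 * C + 2 * H) * ‖x - y‖ *
      Real.exp (-(2 * |kobayashiDist Ω x z - 1 / 2 * Real.log (‖x - y‖ / bdryDist Ω x)|)) := by
  have hx0 := bdryDist_pos hO hne hx
  have hy0 := bdryDist_pos hO hne hy
  set D := ‖x - y‖ with hD
  set τ := kobayashiDist Ω x z with hτ
  have hDx : D * Real.exp (-Real.log (D / bdryDist Ω x)) = bdryDist Ω x := by
    rw [Real.exp_neg, Real.exp_log (by positivity)]; field_simp
  have h1 : bdryDist Ω z ≤ D * Real.exp (2 * (τ - 1 / 2 * Real.log (D / bdryDist Ω x))) := by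
    have h := bdryDist_le_mul_exp hO hC hne hz hx
    rw [kobayashiDist_comm Ω z x, ← hτ] at h
    calc bdryDist Ω z ≤ _ := h
      _ = D * (Real.exp (-Real.log (D / bdryDist Ω x)) * Real.exp (2 * τ)) := by
        rw [← mul_assoc, hDx]
      _ = _ := by rw [← Real.exp_add]; ring_nf
  have hone : 1 ≤ Real.exp (2 * C + 2 * H) := Real.one_le_exp (by positivity)
  -- Past the top, `δ z` is compared with `δ y`; before it, the comparison `h1` with `δ x` suffices.
  rcases abs_cases (τ - 1 / 2 * Real.log (D / bdryDist Ω x)) with ⟨habs, -⟩ | ⟨habs, -⟩ <;> rw [habs]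
  -- For `δ ≤ 2D`, `1 + D/δ ≤ 3 D/δ`; the resulting `2 log 3` is the source of the constant `9`.
  · have h2 : ∀ δ, 0 < δ → δ ≤ 2 * D → Real.log (1 + D / δ) ≤ Real.log 3 + Real.log (D / δ) := by
      intro δ hδ hle
      rw [← Real.log_mul (by norm_num) (by positivity)]
      refine Real.log_le_log (by positivity) ?_
      have : 1 ≤ 2 * (D / δ) := by rw [← mul_div_assoc, one_le_div hδ]; exact hle
      linarith
    have h := bdryDist_le_mul_exp hO hC hne hz hy
    have h3 : 2 * kobayashiDist Ω z y ≤ 2 * Real.log 3 + Real.log (D / bdryDist Ω y) +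
        (2 * C + 2 * H) + -(2 * (τ - 1 / 2 * Real.log (D / bdryDist Ω x))) := by
      linarith [h2 _ hx0 hδx, h2 _ hy0 hδy]
    calc bdryDist Ω z ≤ _ := h
      _ ≤ bdryDist Ω y * Real.exp (2 * Real.log 3 + Real.log (D / bdryDist Ω y) +
          (2 * C + 2 * H) + -(2 * (τ - 1 / 2 * Real.log (D / bdryDist Ω x)))) := by gcongr
      _ = _ := by
        have h9 : Real.exp (2 * Real.log 3) = 9 := by
          rw [mul_comm, Real.exp_mul, Real.exp_log (by norm_num)]; norm_num
        rw [Real.exp_add, Real.exp_add, Real.exp_add, h9, Real.exp_log (by positivity)]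
        field_simp
  · rw [mul_neg, neg_neg]
    refine h1.trans ?_
    have : D ≤ 9 * Real.exp (2 * C + 2 * H) * D := by nlinarith
    gcongr

/-- Length of bi-Lipschitz curves which are close to satisfying the reverse triangle inequality. -/
theorem exists_length_le [ProperSpace E] {m : ℝ} (h : IsBoundedMConvex m Ω)
    (hD : HasDiniSmoothBoundary Ω) (hne : (frontier Ω).Nonempty) {lam H : ℝ} (hlam : 1 ≤ lam)
    (hH : 0 ≤ H) :
    ∃ C : ℝ, 0 < C ∧ ∀ (a b : ℝ) (γ : ℝ → E), a ≤ b → MapsTo γ (Icc a b) Ω →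
      (∀ s ∈ Icc a b, ∀ t ∈ Icc a b, lam⁻¹ * |s - t| ≤ kobayashiDist Ω (γ s) (γ t)) →
      (∀ s ∈ Icc a b, ∀ t ∈ Icc a b, kobayashiDist Ω (γ s) (γ t) ≤ lam * |s - t|) →
      (∀ t ∈ Icc a b, ∀ s ∈ Icc a t, kobayashiDist Ω (γ a) (γ s) + kobayashiDist Ω (γ s) (γ t) ≤
        kobayashiDist Ω (γ a) (γ t) + H) →
      eVariationOn γ (Icc a b) ≤ ENNReal.ofReal (C * ‖γ a - γ b‖ ^ (1 / m)) := by
  have hlam0 : 0 < lam := one_pos.trans_le hlam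
  have hm0 : 0 < m := one_pos.trans h.one_lt
  obtain ⟨C₁, hC₁pos, hC₁⟩ := exists_length_le_of_lt_bdryDist h hne hlam
  obtain ⟨C₂, hC₂pos, hC₂⟩ := h.exists_norm_sub_le hne
  obtain ⟨C₃, hC₃pos, hC₃⟩ := exists_kobayashiDist_le h.isOpen h.convex h.bounded hne hD
  set B := 9 * Real.exp (2 * C₃ + 2 * H) * Real.exp H with hB
  have hBpos : 0 < B := by positivity
  -- `δ` decays at rate `1 / lam` in the parameter, and the power `1 / m` divides the rate by `m`.
  set c := 1 / (lam * m) with hc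
  have hcpos : 0 < c := by positivity
  set K := C₂ * Real.exp (2 * lam) * B ^ (1 / m) * lam with hK
  have hKpos : 0 < K := by positivity
  refine ⟨max C₁ (2 * K / c), lt_max_of_lt_left hC₁pos,
    fun a b γ hab hmaps hlow hup hgeo => ?_⟩
  have ha := left_mem_Icc.2 hab
  have hb := right_mem_Icc.2 hab
  have hmon : ∀ C', C' ≤ max C₁ (2 * K / c) → ENNReal.ofReal (C' * ‖γ a - γ b‖ ^ (1 / m)) ≤
      ENNReal.ofReal (max C₁ (2 * K / c) * ‖γ a - γ b‖ ^ (1 / m)) := fun C' hC' =>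
    ENNReal.ofReal_le_ofReal (by gcongr)
  rcases (norm_nonneg (γ a - γ b)).eq_or_lt with h0 | hDpos
  · have hxy : γ a = γ b := sub_eq_zero.1 (norm_eq_zero.1 h0.symm)
    have := hlow a ha b hb
    rw [hxy, kobayashiDist_self h.isOpen h.convex (hmaps hb)] at this
    have h2 : |a - b| ≤ 0 := by
      by_contra hlt
      exact absurd this (not_le.2 (mul_pos (inv_pos.2 hlam0) (not_le.1 hlt)))
    have hab' : a = b := by linarith [abs_nonpos_iff.1 h2]
    rw [hab', Icc_self, eVariationOn.subsingleton γ subsingleton_singleton]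
    exact bot_le
  set D := ‖γ a - γ b‖ with hDdef
  have hba : bdryDist Ω (γ b) ≤ bdryDist Ω (γ a) + D := by
    rw [hDdef, norm_sub_rev]; exact bdryDist_le_add _ _ _
  have hab'' : bdryDist Ω (γ a) ≤ bdryDist Ω (γ b) + D := bdryDist_le_add _ _ _
  -- If either boundary distance exceeds `2D`, both exceed `D`, which is the short case.
  by_cases hcase : bdryDist Ω (γ a) ≤ 2 * D ∧ bdryDist Ω (γ b) ≤ 2 * D
  swap
  · have h1 : D ≤ bdryDist Ω (γ a) ∧ D ≤ bdryDist Ω (γ b) := by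
      rw [not_and_or, not_le, not_le] at hcase
      rcases hcase with h1 | h1 <;> constructor <;> linarith
    exact (hC₁ a b γ hab hmaps hlow hup hDpos h1.1 h1.2).trans (hmon _ (le_max_left _ _))
  obtain ⟨hδa, hδb⟩ := hcase
  set A := 1 / 2 * Real.log (D / bdryDist Ω (γ a)) with hA
  set τ : ℝ → ℝ := fun t => kobayashiDist Ω (γ a) (γ t) with hτ
  have hτlip : ∀ s ∈ Icc a b, ∀ t ∈ Icc a b, τ s ≤ τ t + lam * |s - t| := fun s hs t ht => by
    have h1 := kobayashiDist_triangle h.isOpen h.convex (hmaps ha) (hmaps ht) (hmaps hs)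
    have h2 := hup t ht s hs
    rw [abs_sub_comm] at h2
    linarith
  have hτcont : ContinuousOn τ (Icc a b) := continuousOn_of_abs_sub_le hlam0.le fun s hs t ht => by
    have h1 := hτlip s hs t ht
    have h2 := hτlip t ht s hs
    rw [abs_sub_comm t s] at h2
    exact abs_sub_le_iff.2 ⟨by linarith, by linarith⟩
  -- The approximate reverse triangle inequality turns separation along the curve into a change of
  -- the distance `τ` from `γ a`.
  have hτgrow : ∀ s ∈ Icc a b, ∀ t ∈ Icc a b, lam⁻¹ * |s - t| - H ≤ |τ s - τ t| := by
    have key : ∀ s ∈ Icc a b, ∀ t ∈ Icc a b, s ≤ t → lam⁻¹ * |s - t| - H ≤ |τ s - τ t| := by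
      intro s hs t ht hst
      have h1 := hgeo t ht s ⟨hs.1, hst⟩
      have h2 := hlow s hs t ht
      have h3 := neg_le_abs (τ s - τ t)
      simp only [hτ] at *
      linarith
    intro s hs t ht
    rcases le_total s t with hst | hst
    · exact key s hs t ht hst
    · rw [abs_sub_comm s t, abs_sub_comm (τ s)]
      exact key t ht s hs hst
  -- The top level `A` need not be a value of `τ`; the closest parameter serves as well, since `|τ t
  -- - τ t₀| ≤ 2 |τ t - A|`.
  obtain ⟨t₀, ht₀, hmin⟩ := isCompact_Icc.exists_isMinOn (nonempty_Icc.2 hab)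
    ((hτcont.sub continuousOn_const).abs (f := fun t => τ t - A))
  have hdecay : ∀ t ∈ Icc a b, bdryDist Ω (γ t) ≤ B * D * Real.exp (-(lam⁻¹ * |t - t₀|)) := by
    intro t ht
    have hne' : γ a ≠ γ b := fun he => by
      rw [hDdef, he, sub_self, norm_zero] at hDpos; exact lt_irrefl _ hDpos
    have h1 := bdryDist_le_exp_neg_abs h.isOpen h.convex hne hC₃pos.le hH (hmaps ha) (hmaps hb)
      (hmaps ht) hDpos (hC₃ _ (hmaps ha) _ (hmaps hb) hne') hδa hδb (hgeo b hb t ht)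
    refine h1.trans ?_
    have h2 : |τ t₀ - A| ≤ |τ t - A| := hmin ht
    have h3 : |τ t - τ t₀| ≤ |τ t - A| + |τ t₀ - A| := by
      calc |τ t - τ t₀| = |(τ t - A) - (τ t₀ - A)| := by congr 1; ring
        _ ≤ _ := abs_sub _ _
    have h4 := hτgrow t ht t₀ ht₀
    have h5 : -(2 * |kobayashiDist Ω (γ a) (γ t) - A|) ≤ H + -(lam⁻¹ * |t - t₀|) := by
      simp only [hτ] at *
      linarith
    calc 9 * Real.exp (2 * C₃ + 2 * H) * D * Real.exp (-(2 * |kobayashiDist Ω (γ a) (γ t) - A|))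
        ≤ 9 * Real.exp (2 * C₃ + 2 * H) * D * Real.exp (H + -(lam⁻¹ * |t - t₀|)) := by gcongr
      _ = _ := by rw [Real.exp_add H, hB]; ring
  refine (eVariationOn_le_of_exp_decay (K := K * D ^ (1 / m)) hcpos (by positivity) ht₀
    fun s hs t ht hst => ?_).trans (le_trans (le_of_eq ?_) (hmon _ (le_max_right _ _)))
  · have hd := hup s hs t ht
    have h1 := hC₂ _ (hmaps hs) _ (hmaps ht) _ lam (hdecay s hs) (hd.trans (by nlinarith))
    have h2 : (B * D * Real.exp (-(lam⁻¹ * |s - t₀|))) ^ (1 / m) =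
        B ^ (1 / m) * D ^ (1 / m) * Real.exp (-(c * |s - t₀|)) := by
      rw [Real.mul_rpow (by positivity) (by positivity), Real.mul_rpow hBpos.le hDpos.le,
        ← Real.exp_mul]
      congr 2
      rw [hc]; field_simp
    rw [h2] at h1
    calc ‖γ t - γ s‖ ≤ _ := h1
      _ ≤ C₂ * Real.exp (2 * lam) * (B ^ (1 / m) * D ^ (1 / m) * Real.exp (-(c * |s - t₀|))) *
          (lam * |s - t|) := by gcongr
      _ = _ := by rw [hK]; ring
  · congr 1; ring

/-! ### Geodesics and quasi-geodesics: conclusion. -/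

theorem frontier_nonempty_of_isBounded [Nontrivial E] (hne : Ω.Nonempty)
    (hB : Bornology.IsBounded Ω) : (frontier Ω).Nonempty := by
  refine nonempty_frontier_iff.2 ⟨hne, ?_⟩
  rintro rfl
  exact NormedSpace.unbounded_univ ℝ E hB

theorem IsKobayashiGromovHyperbolic.exists_four_point (h : IsKobayashiGromovHyperbolic Ω) :
    ∃ δ : ℝ, 0 < δ ∧ ∀ x ∈ Ω, ∀ y ∈ Ω, ∀ z ∈ Ω, ∀ w ∈ Ω,
      kobayashiDist Ω x y + kobayashiDist Ω z w ≤
        max (kobayashiDist Ω x z + kobayashiDist Ω y w) (kobayashiDist Ω x w + kobayashiDist Ω y z) +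
          2 * δ := by
  obtain ⟨δ, hδ, h⟩ := h
  -- The stability lemma needs a strictly positive constant.
  refine ⟨δ + 1, by linarith, fun x hx y hy z hz w hw => ?_⟩
  have h1 := h x hx y hy z hz w hw
  simp only [gromovProduct, kobayashiDist_comm Ω z y] at h1
  rcases min_cases ((kobayashiDist Ω x w + kobayashiDist Ω z w - kobayashiDist Ω x z) / 2)
    ((kobayashiDist Ω z w + kobayashiDist Ω y w - kobayashiDist Ω y z) / 2) with ⟨h2, -⟩ | ⟨h2, -⟩ <;>
    rw [h2] at h1
  · have := le_max_left (kobayashiDist Ω x z + kobayashiDist Ω y w)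
      (kobayashiDist Ω x w + kobayashiDist Ω y z)
    linarith
  · have := le_max_right (kobayashiDist Ω x z + kobayashiDist Ω y w)
      (kobayashiDist Ω x w + kobayashiDist Ω y z)
    linarith

/-- On a geodesic the triangle inequality is an equality, so `lam = 1` and `H = 0` apply without
hyperbolicity. -/
theorem exists_length_geodesic_le [ProperSpace E] [Nontrivial E] {m : ℝ} (h : IsBoundedMConvex m Ω)
    (hD : HasDiniSmoothBoundary Ω) :
    ∃ C : ℝ, 0 < C ∧ ∀ x ∈ Ω, ∀ y ∈ Ω, ∀ γ : ℝ → E, IsKobayashiGeodesic Ω x y γ →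
      euclideanLength γ 0 (kobayashiDist Ω x y) ≤ ENNReal.ofReal (C * ‖x - y‖ ^ (1 / m)) := by
  obtain ⟨C, hCpos, hC⟩ := exists_length_le h hD
    (frontier_nonempty_of_isBounded h.nonempty h.bounded) le_rfl le_rfl
  refine ⟨C, hCpos, fun x hx y hy γ hγ => ?_⟩
  have hd := kobayashiDist_nonneg Ω x y
  have := hC 0 (kobayashiDist Ω x y) γ hd hγ.mapsTo
    (fun s hs t ht => by rw [hγ.isometry s hs t ht, inv_one, one_mul])
    (fun s hs t ht => by rw [hγ.isometry s hs t ht, one_mul])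
    (fun t ht s hs => by
      have hsm : s ∈ Icc 0 (kobayashiDist Ω x y) := ⟨hs.1, hs.2.trans ht.2⟩
      have h0 := left_mem_Icc.2 hd
      rw [hγ.isometry 0 h0 s hsm, hγ.isometry s hsm t ht, hγ.isometry 0 h0 t ht, zero_sub,
        zero_sub, abs_neg, abs_neg, abs_of_nonneg hs.1, abs_of_nonneg ht.1, abs_sub_comm,
        abs_of_nonneg (sub_nonneg.2 hs.2)]
      linarith)
  rwa [hγ.source, hγ.target] at this

theorem exists_length_quasiGeodesic_le [ProperSpace E] [Nontrivial E] {m : ℝ}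
    (h : IsBoundedMConvex m Ω) (hD : HasDiniSmoothBoundary Ω) (hG : IsKobayashiGromovHyperbolic Ω)
    {lam : ℝ} (hlam : 1 ≤ lam) :
    ∃ C : ℝ, 0 < C ∧ ∀ x ∈ Ω, ∀ y ∈ Ω, ∀ (a b : ℝ) (γ : ℝ → E),
      IsKobayashiQuasiGeodesic Ω lam x y a b γ →
        euclideanLength γ a b ≤ ENNReal.ofReal (C * ‖x - y‖ ^ (1 / m)) := by
  obtain ⟨δ, hδ, h4⟩ := hG.exists_four_point
  obtain ⟨H, hH, hstab⟩ := quasiGeodesic_stability hδ hlam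
  obtain ⟨C, hCpos, hC⟩ := exists_length_le h hD
    (frontier_nonempty_of_isBounded h.nonempty h.bounded) hlam hH
  refine ⟨C, hCpos, fun x _ y _ a b γ hγ => ?_⟩
  have := hC a b γ hγ.le hγ.mapsTo hγ.lower hγ.upper fun t ht s hs => by
    have hsub : Icc a t ⊆ Icc a b := Icc_subset_Icc_right ht.2
    have hm := hγ.mapsTo.mono_left hsub
    -- Stability is applied to each initial arc `[a, t]`, itself a quasi-geodesic with the same
    -- constant.
    exact hstab a t (fun s t => kobayashiDist Ω (γ s) (γ t)) ht.1
      (fun s hs => kobayashiDist_self h.isOpen h.convex (hm hs))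
      (fun s _ t _ => kobayashiDist_comm _ _ _)
      (fun s hs t ht u hu => kobayashiDist_triangle h.isOpen h.convex (hm hs) (hm ht) (hm hu))
      (fun s hs t ht => hγ.lower s (hsub hs) t (hsub ht))
      (fun s hs t ht => hγ.upper s (hsub hs) t (hsub ht))
      (fun s hs t ht u hu v hv => h4 _ (hm hs) _ (hm ht) _ (hm hu) _ (hm hv)) s hs
  rwa [hγ.source, hγ.target] at this

end GehringHayman

theorem theorem1p6 (n : ℕ) (hn : 2 ≤ n) (m : ℝ) (Ω : Set (EuclideanSpace ℂ (Fin n)))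
    (hΩ : GehringHayman.IsBoundedMConvex m Ω) (hDini : GehringHayman.HasDiniSmoothBoundary Ω) :
    (∃ C : ℝ, 0 < C ∧ ∀ x ∈ Ω, ∀ y ∈ Ω, ∀ γ : ℝ → EuclideanSpace ℂ (Fin n),
      GehringHayman.IsKobayashiGeodesic Ω x y γ →
        GehringHayman.euclideanLength γ 0 (GehringHayman.kobayashiDist Ω x y) ≤
          ENNReal.ofReal (C * ‖x - y‖ ^ (1 / m))) ∧
    (GehringHayman.IsKobayashiGromovHyperbolic Ω →
      ∀ lam : ℝ, 1 ≤ lam → ∃ C' : ℝ, 0 < C' ∧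
        ∀ x ∈ Ω, ∀ y ∈ Ω, ∀ (a b : ℝ) (γ : ℝ → EuclideanSpace ℂ (Fin n)),
          GehringHayman.IsKobayashiQuasiGeodesic Ω lam x y a b γ →
            GehringHayman.euclideanLength γ a b ≤
              ENNReal.ofReal (C' * ‖x - y‖ ^ (1 / m))) := by
  -- This gives the `Nontrivial` instance by which a bounded domain has a boundary.
  have : Nonempty (Fin n) := ⟨⟨0, by omega⟩⟩
  exact ⟨GehringHayman.exists_length_geodesic_le hΩ hDini,
    fun hG lam hlam => GehringHayman.exists_length_quasiGeodesic_le hΩ hDini hG hlam⟩
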